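/- **Conventions.** A *QPT* is a family $\{C_n\}_{n\in\mathbb N}$ of quantum circuits, indexed by the security parameter $n$, over a fixed finite universal set of admissible gates (preparation of $|0\rangle$, tracing out a qubit, computational-basis measurement, Hadamard, $T$ and CNOT), such that some classical polynomial-time Turing machine prints a description of $C_n$ on input $1^n$. A family of states is *efficiently preparable* if it is the output of a QPT without quantum input. A function $f:\mathbb N\to[0,\infty)$ is *negligible* if for every nonzero polynomial $p$ with coefficients in $\mathbb{N}$, $f(n)<1/p(n)$ for all sufficiently large $n$. A family $G:\{0,1\}^n\to\{0,1\}^{m(n)}$ is a *qPRG* if it is computed by a polynomial-time uniform family of classical Boolean circuits and for every QPT $\mathcal D$ with one output qubit, $$\Bigl|\Pr_{s\in_R\{0,1\}^n}[\mathcal D(G(s))=1]-\Pr_{y\in_R\{0,1\}^{m(n)}}[\mathcal D(y)=1]\Bigr|$$ is negligible in $n$. For $r\in\{0,1\}^{2k}$ let $P_r=\prod_{j=1}^{k}X_j^{r_{2j-1}}Z_j^{r_{2j}}$ be the associated Pauli operator on $k$ qubits, and for a $k$-qubit register $A$, an arbitrary register $B$ and a state $\rho$ on $AB$ let $\mathbb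 P_{r;A}(\rho)=(P_r\otimes\mathbb 1_B)\,\rho\,(P_r\otimes\mathbb 1_B)^\dagger$. **Lemma.** Let $G:\{0,1\}^n\to\{0,1\}^{2k(n)}$ be a qPRG, let $A$ be a register of $k(n)$ qubits and $B$ a register of an arbitrary number $b(n)$ of qubits. Then for all efficiently preparable (families of) states $\rho_{AB}\in\mathfrak D(\mathcal H_A\otimes\mathcal H_B)$ and $\sigma_A\in\mathfrak D(\mathcal H_A)$, with $\rho_B=\operatorname{tr}_A\rho_{AB}$, and for every QPT $\mathcal D$ with one output qubit, $$\Bigl|\Pr_{s\in_R\{0,1\}^n}\bigl[\mathcal D(\mathbb P_{G(s);A}(\rho_{AB}))=1\bigr]-\Pr_{s\in_R\{0,1\}^n}\bigl[\mathcal D(\mathbb P_{G(s);A}(\sigma_A\otimes\rho_B))=1\bigr]\Bigr|$$ is negligible in $n$. -/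

import Mathlib

open scoped ComplexOrder Kronecker

namespace QCrypt

/-! ### Bit strings, operators and states -/

/-- Bit strings of length `n`. -/
abbrev Bits (n : ℕ) : Type := Fin n → Bool

/-- Linear operators on the space of `n` qubits, as matrices in the computational basis. -/
abbrev Op (n : ℕ) : Type := Matrix (Bits n) (Bits n) ℂ

/-- Density operators: positive semidefinite operators of trace one. -/
def IsDensity {n : ℕ} (ρ : Op n) : Prop := ρ.PosSemidef ∧ ρ.trace = 1

/-- The basis state `|x⟩⟨x|`. -/
noncomputable def basisState {n : ℕ} (x : Bits n) : Op n := Matrix.single x x 1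

/-- The tensor product of an operator on `a` qubits and an operator on `b` qubits;
the first `a` wires carry the first factor. -/
noncomputable def tensor {a b : ℕ} (S : Op a) (T : Op b) : Op (a + b) :=
  Matrix.reindex (Fin.appendEquiv a b) (Fin.appendEquiv a b) (S ⊗ₖ T)

/-- The reduced operator on the last `b` qubits: the first `a` qubits are traced out. -/
noncomputable def traceOutFirst {a b : ℕ} (ρ : Op (a + b)) : Op b :=
  Matrix.of fun x y => ∑ z : Bits a, ρ (Fin.append z x) (Fin.append z y)

/-- The one-qubit operator `U` acting on wire `i` of `n` wires, and the identity elsewhere. -/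
noncomputable def onWire {n : ℕ} (i : Fin n) (U : Matrix Bool Bool ℂ) : Op n :=
  Matrix.of fun x y => if ∀ j, j ≠ i → x j = y j then U (x i) (y i) else 0

/-! ### Pauli operators and the quantum one-time pad -/

noncomputable def pauliX : Matrix Bool Bool ℂ :=
  Matrix.of fun a b => if a = b then 0 else 1

noncomputable def pauliZ : Matrix Bool Bool ℂ :=
  Matrix.diagonal fun a => if a then -1 else 1

/-- The Pauli operator `P_r = ∏ j, X_j ^ r_{2j-1} * Z_j ^ r_{2j}` on `k` qubits
(indices of `r` are shifted by one, because `Fin` counts from zero). -/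
noncomputable def pauli {k : ℕ} (r : Bits (2 * k)) : Op k :=
  (List.ofFn fun j : Fin k =>
    onWire j pauliX ^ (r ⟨2 * j, by omega⟩).toNat *
      onWire j pauliZ ^ (r ⟨2 * j + 1, by omega⟩).toNat).prod

/-- The one-time pad with key `r` on the register `A` of the first `k` qubits:
conjugation by `P_r ⊗ 1`. -/
noncomputable def padFirst {k b : ℕ} (r : Bits (2 * k)) (ρ : Op (k + b)) : Op (k + b) :=
  tensor (pauli r) (1 : Op b) * ρ * (tensor (pauli r) (1 : Op b)).conjTranspose

/-! ### Quantum circuits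

The wires of a circuit are kept in a list. Each gate is an admissible map from `n` qubits to `m`
qubits, from a finite universal set: preparation of `|0⟩`, tracing out a wire, measurement in the
computational basis, Hadamard, `T` and controlled-not. -/

noncomputable def hadamard : Matrix Bool Bool ℂ :=
  Matrix.of fun a b => ((if a && b then -1 else 1 : ℝ) / Real.sqrt 2 : ℝ)

noncomputable def tMatrix : Matrix Bool Bool ℂ :=
  Matrix.diagonal fun a => if a then Complex.exp (Real.pi * Complex.I / 4) else 1

/-- Gates with `n` input wires and `m` output wires. A new wire gets the index `0`, and the
wires that were there move up by one; when wire `i` is traced out, those after it move down. -/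
inductive QGate : ℕ → ℕ → Type
  | anc {n : ℕ} : QGate n (n + 1)
  | disc {n : ℕ} (i : Fin (n + 1)) : QGate (n + 1) n
  | meas {n : ℕ} (i : Fin n) : QGate n n
  | had {n : ℕ} (i : Fin n) : QGate n n
  | tee {n : ℕ} (i : Fin n) : QGate n n
  | cnot {n : ℕ} (c t : Fin n) (hct : c ≠ t) : QGate n n

/-- The admissible map of a gate. -/
noncomputable def QGate.apply : {n m : ℕ} → QGate n m → Op n → Op m
  | _, _, .anc, ρ => Matrix.of fun x y =>
      if x 0 = false ∧ y 0 = false then ρ (Fin.tail x) (Fin.tail y) else 0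
  | _, _, .disc i, ρ => Matrix.of fun x y => ∑ b : Bool, ρ (i.insertNth b x) (i.insertNth b y)
  | _, _, .meas i, ρ => Matrix.of fun x y => if x i = y i then ρ x y else 0
  | _, _, .had i, ρ => onWire i hadamard * ρ * (onWire i hadamard).conjTranspose
  | _, _, .tee i, ρ => onWire i tMatrix * ρ * (onWire i tMatrix).conjTranspose
  | _, _, .cnot c t _, ρ => ρ.submatrix
      (fun x => Function.update x t (xor (x t) (x c)))
      (fun x => Function.update x t (xor (x t) (x c)))

/-- Quantum circuits with `n` input wires and `m` output wires: sequences of gates. -/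
inductive QCircuit : ℕ → ℕ → Type
  | nil {n : ℕ} : QCircuit n n
  | cons {n m p : ℕ} (g : QGate n m) (C : QCircuit m p) : QCircuit n p

/-- The admissible map of a circuit. -/
noncomputable def QCircuit.apply : {n m : ℕ} → QCircuit n m → Op n → Op m
  | _, _, .nil, ρ => ρ
  | _, _, .cons g C, ρ => C.apply (g.apply ρ)

/-- The alphabet in which quantum circuits are described. -/
inductive QSymb : Type
  | anc | disc | meas | had | tee | cnot | sep | tick
  deriving DecidableEq

/-- The description of a gate: its name, followed by its wires in unary. -/
def QGate.encode : {n m : ℕ} → QGate n m → List QSymb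
  | _, _, .anc => [.anc]
  | _, _, .disc i => .disc :: List.replicate i .tick
  | _, _, .meas i => .meas :: List.replicate i .tick
  | _, _, .had i => .had :: List.replicate i .tick
  | _, _, .tee i => .tee :: List.replicate i .tick
  | _, _, .cnot c t _ => .cnot :: (List.replicate c .tick ++ .sep :: List.replicate t .tick)

/-- The description of a circuit. -/
def QCircuit.encode : {n m : ℕ} → QCircuit n m → List QSymb
  | _, _, .nil => []
  | _, _, .cons g C => g.encode ++ C.encode

/-! ### Classical Boolean circuits -/

/-- Classical gates: constants, NAND (the result is a new wire with index `0`), and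
discarding a wire. -/
inductive BGate : ℕ → ℕ → Type
  | const {n : ℕ} (b : Bool) : BGate n (n + 1)
  | nand {n : ℕ} (i j : Fin n) : BGate n (n + 1)
  | disc {n : ℕ} (i : Fin (n + 1)) : BGate (n + 1) n

def BGate.eval : {n m : ℕ} → BGate n m → Bits n → Bits m
  | _, _, .const b, x => Fin.cons b x
  | _, _, .nand i j, x => Fin.cons (!(x i && x j)) x
  | _, _, .disc i, x => i.removeNth x

/-- Boolean circuits with `n` input wires and `m` output wires. -/
inductive BCircuit : ℕ → ℕ → Type
  | nil {n : ℕ} : BCircuit n n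
  | cons {n m p : ℕ} (g : BGate n m) (C : BCircuit m p) : BCircuit n p

def BCircuit.eval : {n m : ℕ} → BCircuit n m → Bits n → Bits m
  | _, _, .nil, x => x
  | _, _, .cons g C, x => C.eval (g.eval x)

/-- The alphabet in which Boolean circuits are described. -/
inductive BSymb : Type
  | zero | one | nand | disc | sep | tick
  deriving DecidableEq

def BGate.encode : {n m : ℕ} → BGate n m → List BSymb
  | _, _, .const b => [if b then .one else .zero]
  | _, _, .nand i j => .nand :: (List.replicate i .tick ++ .sep :: List.replicate j .tick)
  | _, _, .disc i => .disc :: List.replicate i .tick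

def BCircuit.encode : {n m : ℕ} → BCircuit n m → List BSymb
  | _, _, .nil => []
  | _, _, .cons g C => g.encode ++ C.encode

/-! ### Uniform families -/

/-- A polynomial-time Turing machine prints the word `w n` on input `n` in unary. -/
def PolyTimePrintable {S : Type} (w : ℕ → List S) : Prop :=
  Nonempty (Turing.TM2ComputableInPolyTime Computability.unaryEncodeNat id w)

/-- A quantum polynomial-time algorithm (QPT): a polynomial-time uniform family of quantum
circuits, indexed by the security parameter `n`. -/
def IsQPT {a c : ℕ → ℕ} (C : ∀ n, QCircuit (a n) (c n)) : Prop :=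
  PolyTimePrintable fun n => (C n).encode

/-- A function family `{0,1}^n → {0,1}^(m n)` is PT-computable if a polynomial-time uniform
family of Boolean circuits computes it. -/
def PTComputable {m : ℕ → ℕ} (f : ∀ n, Bits n → Bits (m n)) : Prop :=
  ∃ B : ∀ n, BCircuit n (m n),
    (PolyTimePrintable fun n => (B n).encode) ∧ ∀ n x, (B n).eval x = f n x

/-- A family of states is efficiently preparable if a QPT without quantum input outputs it.
(An operator on zero qubits is a `1 × 1` matrix; `1` is the only state.) -/
def EfficientlyPreparable {a : ℕ → ℕ} (ρ : ∀ n, Op (a n)) : Prop :=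
  ∃ C : ∀ n, QCircuit 0 (a n), IsQPT C ∧ ∀ n, (C n).apply 1 = ρ n

/-! ### Probabilities, negligible functions, pseudorandom generators -/

/-- `Pr[D(ρ) = 1]`: the probability that the output qubit of `D`, run on `ρ`, is found
to be `1`. -/
noncomputable def prOne {n : ℕ} (D : QCircuit n 1) (ρ : Op n) : ℝ :=
  (D.apply ρ (fun _ => true) (fun _ => true)).re

/-- The average over a uniformly random bit string. -/
noncomputable def unifAvg {n : ℕ} (p : Bits n → ℝ) : ℝ := (∑ s, p s) / 2 ^ n

/-- `f` is eventually smaller than the inverse of each polynomial. -/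
def Negligible (f : ℕ → ℝ) : Prop :=
  ∀ p : Polynomial ℕ, p ≠ 0 → ∀ᶠ n : ℕ in Filter.atTop, f n < 1 / ((p.eval n : ℕ) : ℝ)

/-- Quantum-secure pseudorandom generators. -/
def IsQPRG {m : ℕ → ℕ} (G : ∀ n, Bits n → Bits (m n)) : Prop :=
  PTComputable G ∧
    ∀ D : ∀ n, QCircuit (m n) 1, IsQPT D →
      Negligible fun n =>
        |unifAvg (fun s : Bits n => prOne (D n) (basisState (G n s))) -
          unifAvg (fun y : Bits (m n) => prOne (D n) (basisState y))|

end QCrypt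

open QCrypt

/-! The argument is a hybrid over the key. Replace the pseudorandom key by a uniformly random one:
the padded state then no longer depends on register `A`. Summing over the `Z`-parts of the keys
kills all entries that are off-diagonal in `A`, and summing over the `X`-parts then averages the
diagonal ones, so `∑ r, padFirst r ρ` is a multiple of `1 ⊗ ρ_B` (`sum_padFirst`). Since `σ` has
trace one, `ρ` and `σ ⊗ ρ_B` have the same reduced state on `B`, and `D` accepts both with equal
probability under a uniform key (`unifAvg_padFirst`). Two replacements of the key and the triangle
inequality give the claim.

Each replacement costs a negligible amount, because `D` turns into a distinguisher against `G`
itself: on input `y`, prepare the state, apply the pad with key `y`, run `D`, discard the key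
(`exists_key_distinguisher`). The pad becomes a fixed circuit controlled by the key wires, using `H
X H = Z`. Only keys in basis states matter, so circuits are compared on a family of inputs
(`Realizes`). The key occupies the last wires, so the given circuits run beside it with unchanged
descriptions.

Most of the work is uniformity: the description of the new distinguisher must be printed by a
polynomial-time machine, obtained from those that print the given circuits. A small language of
register programs is compiled to stack machines, and `PolyTimePrintable.of_exec` shows that a word
computed by such a program from two printable words, at polynomial cost, is printable. The sizes `k
n` and `k n + b n` are not assumed computable; they are read off, in unary, from the descriptions of
the circuits that prepare `σ` and `ρ` (`EfficientlyPreparable.printable_outWires`). -/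

namespace QCrypt

open Turing Function

/-! ### Fragments of stack machines -/

section Fragments

variable {K : Type} [DecidableEq K] {Γ : K → Type} {Λ Λ' σ : Type}

/-- Runs of a stack machine with exactly the given number of steps. -/
inductive Steps (M : Λ → TM2.Stmt Γ Λ σ) : ℕ → TM2.Cfg Γ Λ σ → TM2.Cfg Γ Λ σ → Prop
  | refl (c) : Steps M 0 c c
  | cons {c c' c'' t} : TM2.step M c = some c' → Steps M t c' c'' → Steps M (t + 1) c c''

theorem Steps.trans {M : Λ → TM2.Stmt Γ Λ σ} {s t : ℕ} {c c' c'' : TM2.Cfg Γ Λ σ}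
    (h : Steps M s c c') (h' : Steps M t c' c'') : Steps M (s + t) c c'' := by
  induction h with
  | refl c => simpa using h'
  | cons hs _ ih => rw [Nat.add_right_comm]; exact .cons hs (ih h')

theorem iterate_bind_none {α : Type} (f : α → Option α) (t : ℕ) :
    (flip bind f)^[t] none = none := by
  induction t with
  | zero => rfl
  | succ t ih => rw [iterate_succ_apply]; exact ih

/-- The bridge to Mathlib's notion of evaluation, which iterates `flip bind`. A halted configuration
has no successor and `none` is absorbing, so reaching `some c'` forces every intermediate step to
exist. -/
theorem steps_iff {M : Λ → TM2.Stmt Γ Λ σ} {t : ℕ} {c c' : TM2.Cfg Γ Λ σ} :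
    Steps M t c c' ↔ (flip bind (TM2.step M))^[t] (some c) = some c' := by
  induction t generalizing c with
  | zero =>
    constructor
    · rintro ⟨⟩; rfl
    · intro h; cases h; exact .refl _
  | succ t ih =>
    rw [iterate_succ_apply]
    constructor
    · intro h
      cases h with
      | cons hs h' => rw [show flip bind (TM2.step M) (some c) = TM2.step M c from rfl, hs]
                      exact ih.1 h'
    · intro h
      rw [show flip bind (TM2.step M) (some c) = TM2.step M c from rfl] at h
      cases hs : TM2.step M c with
      | none => rw [hs, iterate_bind_none] at h; cases h
      | some d => rw [hs] at h; exact .cons hs (ih.2 h)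

/-- Rename the labels of a statement and replace halting by a jump to `e`. -/
def relabel (f : Λ → Λ') (e : Option Λ') : TM2.Stmt Γ Λ σ → TM2.Stmt Γ Λ' σ
  | .push k g q => .push k g (relabel f e q)
  | .peek k g q => .peek k g (relabel f e q)
  | .pop k g q => .pop k g (relabel f e q)
  | .load g q => .load g (relabel f e q)
  | .branch p q₁ q₂ => .branch p (relabel f e q₁) (relabel f e q₂)
  | .goto l => .goto fun v => f (l v)
  | .halt => e.elim .halt fun l => .goto fun _ => l

/-- The effect of `relabel` on configurations. -/
def relabelCfg (f : Λ → Λ') (e : Option Λ') (c : TM2.Cfg Γ Λ σ) : TM2.Cfg Γ Λ' σ :=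
  ⟨c.l.elim e fun l => some (f l), c.var, c.stk⟩

theorem stepAux_relabel (f : Λ → Λ') (e : Option Λ') (q : TM2.Stmt Γ Λ σ) (v : σ)
    (S : ∀ k, List (Γ k)) :
    TM2.stepAux (relabel f e q) v S = relabelCfg f e (TM2.stepAux q v S) := by
  induction q generalizing v S with
  | branch p q₁ q₂ ih₁ ih₂ => simp only [relabel, TM2.stepAux]; cases p v <;> simp [ih₁, ih₂]
  | goto l => rfl
  | halt => cases e <;> rfl
  | _ => simp_all [relabel, TM2.stepAux]

/-- The jump to `e` takes place inside the step that would have halted, so leaving a fragment for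
its successor costs no additional step. -/
theorem Steps.relabel {M : Λ → TM2.Stmt Γ Λ σ} {M' : Λ' → TM2.Stmt Γ Λ' σ} {f : Λ → Λ'}
    {e : Option Λ'} (hM : ∀ l, M' (f l) = relabel f e (M l)) {t : ℕ} {c c' : TM2.Cfg Γ Λ σ}
    (h : Steps M t c c') : Steps M' t (relabelCfg f e c) (relabelCfg f e c') := by
  induction h with
  | refl c => exact .refl _
  | @cons c c' c'' t hs _ ih =>
    obtain ⟨_ | l, v, S⟩ := c
    · cases hs
    · refine .cons ?_ ih
      simp only [TM2.step, Option.some.injEq] at hs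
      subst hs
      simp [relabelCfg, TM2.step, hM, stepAux_relabel]

variable (Γ σ) in
/-- A program fragment: a finite set of labelled statements, which is left by halting. -/
structure Frag where
  Λ : Type
  [fin : Fintype Λ]
  main : Λ
  m : Λ → TM2.Stmt Γ Λ σ

/-- The fragment, entered with the stacks `S` and any internal state, is left with the stacks `S'`
after at most `t` steps. -/
def Frag.Runs (F : Frag Γ σ) (S S' : ∀ k, List (Γ k)) (t : ℕ) : Prop :=
  ∀ v, ∃ v', ∃ t' ≤ t, Steps F.m t' ⟨some F.main, v, S⟩ ⟨none, v', S'⟩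

theorem Frag.Runs.mono {F : Frag Γ σ} {S S' : ∀ k, List (Γ k)} {t u : ℕ} (h : F.Runs S S' t)
    (htu : t ≤ u) : F.Runs S S' u := fun v =>
  let ⟨v', t', ht, hs⟩ := h v
  ⟨v', t', ht.trans htu, hs⟩

theorem Frag.Runs.congr {F : Frag Γ σ} {S S' S'' : ∀ k, List (Γ k)} {t u : ℕ} (h : F.Runs S S' t)
    (hS : S' = S'') (htu : t ≤ u) : F.Runs S S'' u := hS ▸ h.mono htu

/-- The fragment that consists of a single statement. -/
def Frag.single (q : TM2.Stmt Γ Unit σ) : Frag Γ σ := ⟨Unit, (), fun _ => q⟩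

theorem Frag.steps_single (q : TM2.Stmt Γ Unit σ) (v : σ) (S : ∀ k, List (Γ k)) :
    Steps (Frag.single q).m 1 ⟨some (Frag.single q).main, v, S⟩ (TM2.stepAux q v S) :=
  .cons rfl (.refl _)

/-- Push a symbol. -/
def Frag.push (k : K) (a : Γ k) : Frag Γ σ := .single (.push k (fun _ => a) .halt)

theorem Frag.runs_push (k : K) (a : Γ k) (S : ∀ k, List (Γ k)) :
    (Frag.push k a : Frag Γ σ).Runs S (update S k (a :: S k)) 1 := fun v =>
  ⟨v, 1, le_rfl, Frag.steps_single _ v S⟩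

/-- Remove the top of a stack. -/
def Frag.drop (k : K) : Frag Γ σ := .single (.pop k (fun v _ => v) .halt)

theorem Frag.runs_drop (k : K) (S : ∀ k, List (Γ k)) :
    (Frag.drop k : Frag Γ σ).Runs S (update S k (S k).tail) 1 := fun v =>
  ⟨v, 1, le_rfl, Frag.steps_single _ v S⟩

/-- The fragment without effect. -/
def Frag.skip : Frag Γ σ := .single .halt

theorem Frag.runs_skip (S : ∀ k, List (Γ k)) : (Frag.skip : Frag Γ σ).Runs S S 1 := fun v =>
  ⟨v, 1, le_rfl, Frag.steps_single _ v S⟩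

/-- Sequential composition. -/
def Frag.seq (F G : Frag Γ σ) : Frag Γ σ :=
  letI := F.fin
  letI := G.fin
  ⟨F.Λ ⊕ G.Λ, .inl F.main, Sum.elim (fun l => relabel .inl (some (.inr G.main)) (F.m l))
    fun l => relabel .inr none (G.m l)⟩

theorem Frag.steps_seq {F G : Frag Γ σ} {t u : ℕ} {v v' v'' : σ} {S S' S'' : ∀ k, List (Γ k)}
    (hF : Steps F.m t ⟨some F.main, v, S⟩ ⟨none, v', S'⟩)
    (hG : Steps G.m u ⟨some G.main, v', S'⟩ ⟨none, v'', S''⟩) :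
    Steps (F.seq G).m (t + u) ⟨some (F.seq G).main, v, S⟩ ⟨none, v'', S''⟩ :=
  (hF.relabel (M' := (F.seq G).m) (f := .inl) (e := some (.inr G.main)) fun _ => rfl).trans
    (hG.relabel (M' := (F.seq G).m) (f := .inr) (e := none) fun _ => rfl)

theorem Frag.Runs.seq {F G : Frag Γ σ} {t u : ℕ} {S S' S'' : ∀ k, List (Γ k)}
    (hF : F.Runs S S' t) (hG : G.Runs S' S'' u) : (F.seq G).Runs S S'' (t + u) := fun v => by
  obtain ⟨v', t', ht, hs⟩ := hF v
  obtain ⟨v'', u', hu, hs'⟩ := hG v'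
  exact ⟨v'', t' + u', by omega, Frag.steps_seq hs hs'⟩

end Fragments

/-! ### Loops that consume a stack -/

section Loop

variable {K : Type} [DecidableEq K] {Γ : K → Type} {A τ : Type} [Fintype A]

/-- Pop the stack `k` until it is empty; for each symbol that is popped, run the body that
`dec` selects. -/
def Frag.loop (k : K) (dec : Γ k → A) (body : A → Frag Γ (Option A × τ)) :
    Frag Γ (Option A × τ) :=
  letI := fun a => (body a).fin
  ⟨Option (Σ a, (body a).Λ), none, fun
    | none => .pop k (fun v o => (o.map dec, v.2)) (.branch (fun v => v.1.isSome)
        (.goto fun v => v.1.map fun a => ⟨a, (body a).main⟩) .halt)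
    | some l => relabel (fun l' => some ⟨l.1, l'⟩) (some none) ((body l.1).m l.2)⟩

theorem Frag.runs_loop_nil {k : K} {dec : Γ k → A} {body : A → Frag Γ (Option A × τ)}
    {S : ∀ k, List (Γ k)} (hS : S k = []) : (Frag.loop k dec body).Runs S S 1 := fun v => by
  refine ⟨(none, v.2), 1, le_rfl, .cons ?_ (.refl _)⟩
  have : update S k [] = S := by rw [← hS]; simp
  simp [Frag.loop, TM2.step, TM2.stepAux, hS, this]

/-- Once the popped symbol has selected a jump, the label remembers it. The body may therefore
overwrite the first component of the state, and nested loops can share it. -/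
theorem Frag.runs_loop_cons {k : K} {dec : Γ k → A} {body : A → Frag Γ (Option A × τ)}
    {S S' S'' : ∀ k, List (Γ k)} {x : Γ k} {l : List (Γ k)} {t u : ℕ} (hS : S k = x :: l)
    (hb : (body (dec x)).Runs (update S k l) S' t) (hl : (Frag.loop k dec body).Runs S' S'' u) :
    (Frag.loop k dec body).Runs S S'' (1 + t + u) := fun v => by
  obtain ⟨v', t', ht, hs⟩ := hb (some (dec x), v.2)
  obtain ⟨v'', u', hu, hs'⟩ := hl v'
  refine ⟨v'', 1 + t' + u', by omega, ?_⟩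
  have h₁ : Steps (Frag.loop k dec body).m 1 ⟨some (Frag.loop k dec body).main, v, S⟩
      ⟨some (some ⟨dec x, (body (dec x)).main⟩), (some (dec x), v.2), update S k l⟩ := by
    refine .cons ?_ (.refl _)
    simp [Frag.loop, TM2.step, TM2.stepAux, hS]
  refine (h₁.trans ?_).trans hs'
  exact hs.relabel (M' := (Frag.loop k dec body).m) (f := fun l' => some ⟨dec x, l'⟩)
    (e := some none) fun _ => rfl

end Loop

/-! ### Machines as fragments -/

section Embedding

variable {ι Z A : Type} {Δ : Z → Type} (M : ι → FinTM2)

/-- Stack alphabets of a machine that contains the machines `M i`. -/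
abbrev JointAlphabet (Δ : Z → Type) (M : ι → FinTM2) : Z ⊕ (Σ i, (M i).K) → Type
  | .inl z => Δ z
  | .inr p => (M p.1).Γ p.2

/-- Internal states of a machine that contains the machines `M i`. -/
abbrev JointState (A : Type) (M : ι → FinTM2) : Type := Option A × ∀ i, (M i).σ

/-- The stacks of the joint machine, as a function of those that belong to the `M i`. -/
def jointStacks (o : ∀ z, List (Δ z)) (T : ∀ i k, List ((M i).Γ k)) :
    ∀ k, List (JointAlphabet Δ M k)
  | .inl z => o z
  | .inr ⟨i, k⟩ => T i k

variable {M}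

@[simp] theorem jointStacks_inl (o : ∀ z, List (Δ z)) (T : ∀ i k, List ((M i).Γ k)) (z : Z) :
    jointStacks M o T (.inl z) = o z := rfl

@[simp] theorem jointStacks_inr (o : ∀ z, List (Δ z)) (T : ∀ i k, List ((M i).Γ k)) (i : ι)
    (k : (M i).K) : jointStacks M o T (.inr ⟨i, k⟩) = T i k := rfl

variable [DecidableEq ι] [DecidableEq Z]

variable (M) in
/-- A statement of the machine `M i` as a statement of the joint machine. -/
def embedStmt (i : ι) : TM2.Stmt (M i).Γ (M i).Λ (M i).σ →
    TM2.Stmt (JointAlphabet Δ M) (M i).Λ (JointState A M)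
  | .push k g q => .push (.inr ⟨i, k⟩) (fun v => g (v.2 i)) (embedStmt i q)
  | .peek k g q => .peek (.inr ⟨i, k⟩) (fun v o => (v.1, update v.2 i (g (v.2 i) o)))
      (embedStmt i q)
  | .pop k g q => .pop (.inr ⟨i, k⟩) (fun v o => (v.1, update v.2 i (g (v.2 i) o)))
      (embedStmt i q)
  | .load g q => .load (fun v => (v.1, update v.2 i (g (v.2 i)))) (embedStmt i q)
  | .branch p q₁ q₂ => .branch (fun v => p (v.2 i)) (embedStmt i q₁) (embedStmt i q₂)
  | .goto l => .goto fun v => l (v.2 i)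
  | .halt => .halt

theorem update_jointStacks_inl (o : ∀ z, List (Δ z)) (T : ∀ i k, List ((M i).Γ k)) (z : Z)
    (l : List (Δ z)) :
    update (jointStacks M o T) (.inl z) l = jointStacks M (update o z l) T := by
  funext k
  rcases k with z' | ⟨i, k⟩
  · by_cases h : z' = z
    · subst h; simp
    · rw [update_of_ne (by simpa using h)]; simp [h]
  · rw [update_of_ne (by simp)]; rfl

theorem update_jointStacks_inr (o : ∀ z, List (Δ z)) (T : ∀ i k, List ((M i).Γ k)) (i : ι)
    (k : (M i).K) (l : List ((M i).Γ k)) :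
    update (jointStacks M o T) (.inr ⟨i, k⟩) l =
      jointStacks M o (update T i (update (T i) k l)) := by
  funext k'
  rcases k' with z' | ⟨j, k'⟩
  · rw [update_of_ne (by simp)]; rfl
  · by_cases h : j = i
    · subst h
      by_cases h' : k' = k
      · subst h'; simp
      · rw [update_of_ne (by simpa using h')]; simp [h']
    · rw [update_of_ne (by rintro ⟨⟩; exact h rfl)]; simp [h]

/-- The simulation invariant: an embedded statement acts on the state and stacks of `M i` as the
original does and touches nothing else. -/
theorem stepAux_embedStmt (i : ι) (q : TM2.Stmt (M i).Γ (M i).Λ (M i).σ) (v : JointState A M)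
    (o : ∀ z, List (Δ z)) (T : ∀ i k, List ((M i).Γ k)) :
    TM2.stepAux (embedStmt M i q) v (jointStacks M o T) =
      ⟨(TM2.stepAux q (v.2 i) (T i)).l, (v.1, update v.2 i (TM2.stepAux q (v.2 i) (T i)).var),
        jointStacks M o (update T i (TM2.stepAux q (v.2 i) (T i)).stk)⟩ := by
  induction q generalizing v T with
  | push k g q ih =>
    simp only [embedStmt, TM2.stepAux, update_jointStacks_inr]
    rw [ih]; simp
  | peek k g q ih => simp only [embedStmt, TM2.stepAux, ih]; simp
  | pop k g q ih =>
    simp only [embedStmt, TM2.stepAux, update_jointStacks_inr]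
    rw [ih]; simp
  | load g q ih => simp only [embedStmt, TM2.stepAux, ih]; simp
  | branch p q₁ q₂ ih₁ ih₂ =>
    simp only [embedStmt, TM2.stepAux]; cases p (v.2 i) <;> simp [ih₁, ih₂]
  | goto l => simp [embedStmt]
  | halt => simp [embedStmt]

theorem Steps.embed (i : ι) {t : ℕ} {c c' : TM2.Cfg (M i).Γ (M i).Λ (M i).σ}
    (h : Steps (M i).m t c c') (v : JointState A M) (o : ∀ z, List (Δ z))
    (T : ∀ i k, List ((M i).Γ k)) :
    Steps (fun l => embedStmt M i ((M i).m l)) t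
      ⟨c.l, (v.1, update v.2 i c.var), jointStacks M o (update T i c.stk)⟩
      ⟨c'.l, (v.1, update v.2 i c'.var), jointStacks M o (update T i c'.stk)⟩ := by
  induction h with
  | refl c => exact .refl _
  | @cons c c' c'' t hs _ ih =>
    obtain ⟨_ | l, w, S⟩ := c
    · cases hs
    · refine .cons ?_ ih
      simp only [TM2.step, Option.some.injEq] at hs
      subst hs
      simp [TM2.step, stepAux_embedStmt]

variable (M) in
/-- The machine `M i`, as a fragment of the joint machine. -/
def Frag.call (i : ι) : Frag (JointAlphabet Δ M) (JointState A M) :=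
  letI := (M i).ΛFin
  ⟨Option (M i).Λ, none, fun
    -- A fragment may be entered in any state, while the run of `M i` is only known from its initial
    -- state; hence an extra entry label that resets this component.
    | none => .load (fun v => (v.1, update v.2 i (M i).initialState))
        (.goto fun _ => some (M i).main)
    | some l => relabel some none (embedStmt M i ((M i).m l))⟩

theorem Frag.runs_call {i : ι} {t : ℕ} {S S' : ∀ k, List ((M i).Γ k)} {w : (M i).σ}
    (h : Steps (M i).m t ⟨some (M i).main, (M i).initialState, S⟩ ⟨none, w, S'⟩)
    (o : ∀ z, List (Δ z)) (T : ∀ i k, List ((M i).Γ k)) (hT : T i = S) :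
    (Frag.call M i : Frag (JointAlphabet Δ M) (JointState A M)).Runs (jointStacks M o T)
      (jointStacks M o (update T i S')) (1 + t) := fun v => by
  refine ⟨(v.1, update v.2 i w), 1 + t, le_rfl, ?_⟩
  have h₁ : Steps (Frag.call M i : Frag (JointAlphabet Δ M) (JointState A M)).m 1
      ⟨some (Frag.call M i : Frag (JointAlphabet Δ M) (JointState A M)).main, v,
        jointStacks M o T⟩
      ⟨some (some (M i).main), (v.1, update v.2 i (M i).initialState), jointStacks M o T⟩ :=
    .cons rfl (.refl _)
  refine h₁.trans ?_
  have h₂ := (h.embed i v o T).relabel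
    (M' := (Frag.call M i : Frag (JointAlphabet Δ M) (JointState A M)).m) (f := some) (e := none)
    fun _ => rfl
  have hT' : update T i S = T := by rw [← hT]; simp
  simp only [relabelCfg, hT'] at h₂
  exact h₂

end Embedding

/-! ### The length of the output of a machine -/

section Growth

variable {K : Type} [DecidableEq K] {Γ : K → Type} {Λ σ : Type}

/-- The number of push instructions in a statement. -/
def pushCount : TM2.Stmt Γ Λ σ → ℕ
  | .push _ _ q => pushCount q + 1
  | .peek _ _ q => pushCount q
  | .pop _ _ q => pushCount q
  | .load _ q => pushCount q
  | .branch _ q₁ q₂ => pushCount q₁ + pushCount q₂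
  | .goto _ => 0
  | .halt => 0

theorem length_update_le (S : ∀ k, List (Γ k)) (k k' : K) (l : List (Γ k)) (c : ℕ)
    (h : l.length ≤ (S k).length + c) : (update S k l k').length ≤ (S k').length + c := by
  by_cases hk : k' = k
  · subst hk; simpa using h
  · rw [update_of_ne hk]; omega

/-- One machine step executes a whole statement, so a stack can grow by several symbols. Counting
the pushes of both branches is crude but sufficient. -/
theorem length_stepAux_le (q : TM2.Stmt Γ Λ σ) (v : σ) (S : ∀ k, List (Γ k)) (k : K) :
    ((TM2.stepAux q v S).stk k).length ≤ (S k).length + pushCount q := by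
  induction q generalizing v S with
  | push k' g q ih =>
    have := length_update_le S k' k (g v :: S k') 1 (by simp)
    have := ih v (update S k' (g v :: S k'))
    simp only [TM2.stepAux, pushCount]
    omega
  | pop k' g q ih =>
    have := length_update_le S k' k (S k').tail 0 (by simp)
    have := ih (g v (S k').head?) (update S k' (S k').tail)
    simp only [TM2.stepAux, pushCount]
    omega
  | branch p q₁ q₂ ih₁ ih₂ =>
    have := ih₁ v S
    have := ih₂ v S
    simp only [TM2.stepAux, pushCount]
    cases p v <;> simp only [cond_true, cond_false] <;> omega
  | peek k' g q ih => exact ih _ _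
  | load g q ih => exact ih _ _
  | _ => simp [pushCount]

theorem Steps.length_le {M : Λ → TM2.Stmt Γ Λ σ} {B : ℕ} (hB : ∀ l, pushCount (M l) ≤ B)
    {t : ℕ} {c c' : TM2.Cfg Γ Λ σ} (h : Steps M t c c') (k : K) :
    (c'.stk k).length ≤ (c.stk k).length + B * t := by
  induction h with
  | refl c => simp
  | @cons c c' c'' t hs _ ih =>
    obtain ⟨_ | l, v, S⟩ := c
    · cases hs
    · simp only [TM2.step, Option.some.injEq] at hs
      subst hs
      have := length_stepAux_le (M l) v S k
      have := hB l
      rw [Nat.mul_add]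
      simp only at ih ⊢
      omega

end Growth

/-! ### Register programs -/

instance : Fintype QSymb :=
  ⟨{.anc, .disc, .meas, .had, .tee, .cnot, .sep, .tick}, fun s => by cases s <;> decide⟩

/-- The registers of a program; each of them is a stack of symbols. -/
inductive Reg : Type
  | out | fst | snd | tmp | cnt
  deriving DecidableEq

instance : Fintype Reg :=
  ⟨{.out, .fst, .snd, .tmp, .cnt}, fun r => by cases r <;> decide⟩

/-- The contents of the registers. -/
def regs (out fst snd tmp cnt : List QSymb) : Reg → List QSymb
  | .out => out
  | .fst => fst
  | .snd => snd
  | .tmp => tmp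
  | .cnt => cnt

/-- Programs that act on the registers. -/
inductive Prog : Type
  | skip
  | push (r : Reg) (s : QSymb)
  | drop (r : Reg)
  | seq (p q : Prog)
  | loop (r : Reg) (body : QSymb → Prog)

/-- `p.Exec o o' t`: the program `p` changes the contents of the registers from `o` to `o'` in at
most `t` steps. -/
inductive Prog.Exec : Prog → (Reg → List QSymb) → (Reg → List QSymb) → ℕ → Prop
  | skip (o) : Exec .skip o o 1
  | push (r s o) : Exec (.push r s) o (update o r (s :: o r)) 1
  | drop (r o) : Exec (.drop r) o (update o r (o r).tail) 1
  | seq {p q o o' o'' t u} : Exec p o o' t → Exec q o' o'' u → Exec (.seq p q) o o'' (t + u)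
  | loopNil {r body o} : o r = [] → Exec (.loop r body) o o 1
  | loopCons {r body o o' o'' s l t u} : o r = s :: l → Exec (body s) (update o r l) o' t →
      Exec (.loop r body) o' o'' u → Exec (.loop r body) o o'' (1 + t + u)
  | mono {p o o' t u} : Exec p o o' t → t ≤ u → Exec p o o' u

theorem Prog.Exec.congr {p : Prog} {o o' o'' : Reg → List QSymb} {t u : ℕ} (h : p.Exec o o' t)
    (ho : o' = o'') (htu : t ≤ u) : p.Exec o o'' u := ho ▸ h.mono htu

/-- Move the contents of `r` to `r'`, which reverses them. -/
def Prog.move (r r' : Reg) : Prog := .loop r fun s => .push r' s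

theorem Prog.exec_move {r r' : Reg} (h : r ≠ r') (o : Reg → List QSymb) :
    (Prog.move r r').Exec o (update (update o r []) r' ((o r).reverse ++ o r'))
      (2 * (o r).length + 1) := by
  induction hl : o r generalizing o with
  | nil =>
    have : update (update o r []) r' (o r') = o := by
      rw [← hl]; simp
    simp only [List.reverse_nil, List.nil_append, this]
    exact Exec.loopNil hl
  | cons s l ih =>
    have hb := Exec.push r' s (update o r l)
    have := ih _ (show update (update o r l) r' (s :: update o r l r') r = l by simp [h])
    refine (Exec.loopCons hl hb this).congr ?_ (by simp; omega)
    · funext x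
      by_cases hx : x = r'
      · subst hx; simp [h.symm]
      · by_cases hx' : x = r
        · subst hx'; simp [h]
        · simp [hx, hx']

/-! ### Programs as fragments of machines -/

/-- The stack alphabets of the main part of a machine: the input stack and the registers. -/
abbrev MainAlphabet : Option Reg → Type
  | none => Bool
  | some _ => QSymb

/-- The stacks of the main part of a machine. -/
def mainStacks (o : Reg → List QSymb) (l : List Bool) : ∀ z, List (MainAlphabet z)
  | none => l
  | some r => o r

theorem update_mainStacks_some (o : Reg → List QSymb) (l : List Bool) (r : Reg)
    (l' : List QSymb) :
    update (mainStacks o l) (some r) l' = mainStacks (update o r l') l := by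
  funext z
  rcases z with _ | r'
  · rw [update_of_ne (by simp)]; rfl
  · by_cases h : r' = r
    · subst h; simp [mainStacks]
    · rw [update_of_ne (by simpa using h)]; simp [mainStacks, h]

theorem update_mainStacks_none (o : Reg → List QSymb) (l l' : List Bool) :
    update (mainStacks o l) none l' = mainStacks o l' := by
  funext z
  rcases z with _ | r'
  · simp [mainStacks]
  · rw [update_of_ne (by simp)]; rfl

section

variable (M : Bool → FinTM2)

/-- Fragments of a machine that contains the machines `M i`. -/
abbrev MainFrag : Type 1 := Frag (JointAlphabet MainAlphabet M) (JointState QSymb M)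

/-- The stacks of a machine that contains the machines `M i`. -/
abbrev allStacks (o : Reg → List QSymb) (l : List Bool) (T : ∀ i k, List ((M i).Γ k)) :
    ∀ k, List (JointAlphabet MainAlphabet M k) := jointStacks M (mainStacks o l) T

/-- A program as a fragment. -/
def Prog.toFrag : Prog → MainFrag M
  | .skip => .skip
  | .push r s => .push (.inl (some r)) s
  | .drop r => .drop (.inl (some r))
  | .seq p q => .seq p.toFrag q.toFrag
  | .loop r body => .loop (.inl (some r)) (fun s : QSymb => s) fun s => (body s).toFrag

variable {M}

/-- Correctness of the compilation, with the same time bound: each construct of the language is one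
fragment, and the input stack and the stacks of the `M i` are left alone. -/
theorem Prog.Exec.runs {p : Prog} {o o' : Reg → List QSymb} {t : ℕ} (h : p.Exec o o' t)
    (l : List Bool) (T : ∀ i k, List ((M i).Γ k)) :
    (p.toFrag M).Runs (allStacks M o l T) (allStacks M o' l T) t := by
  induction h with
  | skip o => exact Frag.runs_skip _
  | push r s o =>
    have := Frag.runs_push (σ := JointState QSymb M) (.inl (some r)) s (allStacks M o l T)
    rwa [update_jointStacks_inl, update_mainStacks_some] at this
  | drop r o =>
    have := Frag.runs_drop (σ := JointState QSymb M) (.inl (some r)) (allStacks M o l T)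
    rwa [update_jointStacks_inl, update_mainStacks_some] at this
  | seq _ _ ih₁ ih₂ => exact ih₁.seq ih₂
  | loopNil ho => exact Frag.runs_loop_nil ho
  | @loopCons r body o o' o'' s l' t u ho _ _ ih₁ ih₂ =>
    refine Frag.runs_loop_cons (k := Sum.inl (some r)) (S := allStacks M o l T) (x := s) (l := l') ho
      ?_ ih₂
    rwa [update_jointStacks_inl, update_mainStacks_some]
  | mono _ htu ih => exact ih.mono htu

/-- The stacks of the machines `M i` that hold `m` copies of the symbol `x i` as input. -/
def feedStacks (x : ∀ i, (M i).Γ (M i).k₀) (m : ℕ) : ∀ i k, List ((M i).Γ k) := fun i =>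
  update (fun _ => []) (M i).k₀ (List.replicate m (x i))

/-- Copy the length of the input to the input stacks of the machines `M i`. -/
def feed (x : ∀ i, (M i).Γ (M i).k₀) : MainFrag M :=
  .loop (.inl none) (fun _ : Bool => QSymb.tick) fun _ =>
    .seq (.push (.inr ⟨false, (M false).k₀⟩) (x false)) (.push (.inr ⟨true, (M true).k₀⟩) (x true))

theorem runs_feed (x : ∀ i, (M i).Γ (M i).k₀) (o : Reg → List QSymb) (l : List Bool) (m : ℕ) :
    (feed x).Runs (allStacks M o l (feedStacks x m))
      (allStacks M o [] (feedStacks x (m + l.length))) (3 * l.length + 1) := by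
  induction l generalizing m with
  | nil => exact Frag.runs_loop_nil rfl
  | cons a l ih =>
    have h₁ := Frag.runs_push (σ := JointState QSymb M) (.inr ⟨false, (M false).k₀⟩) (x false)
      (allStacks M o l (feedStacks x m))
    rw [update_jointStacks_inr] at h₁
    have h₂ := Frag.runs_push (σ := JointState QSymb M) (.inr ⟨true, (M true).k₀⟩) (x true)
      (allStacks M o l (update (feedStacks x m) false (update (feedStacks x m false) (M false).k₀
        (x false :: feedStacks x m false (M false).k₀))))
    rw [update_jointStacks_inr] at h₂
    have h₃ := h₁.seq h₂
    have hT : (update (update (feedStacks x m) false (update (feedStacks x m false) (M false).k₀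
        (x false :: feedStacks x m false (M false).k₀))) true
        (update (feedStacks x m true) (M true).k₀
        (x true :: feedStacks x m true (M true).k₀))) = feedStacks x (m + 1) := by
      funext i
      cases i <;> simp [feedStacks, List.replicate_succ]
    simp only [jointStacks_inr, ne_eq, Bool.true_eq_false, not_false_eq_true, update_of_ne,
      hT] at h₃
    refine (Frag.runs_loop_cons (k := Sum.inl none) (x := a) (l := l)
      (S := allStacks M o (a :: l) (feedStacks x m)) rfl ?_ (ih (m + 1))).congr ?_ (t := 1 + (1 + 1) + _) (by simp; omega)
    · rw [update_jointStacks_inl, update_mainStacks_none]; exact h₃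
    · rw [List.length_cons, Nat.add_right_comm, Nat.add_assoc]

/-- Move the output of the machine `M i` to the register `r`. -/
def fetch (i : Bool) (d : (M i).Γ (M i).k₁ → QSymb) (r : Reg) : MainFrag M :=
  .seq (.loop (.inr ⟨i, (M i).k₁⟩) d fun s => .push (.inl (some .tmp)) s)
    ((Prog.move .tmp r).toFrag M)

/-- Moving a stack reverses it, so the output travels through `tmp` and the two reversals cancel. -/
theorem runs_fetch {i : Bool} (d : (M i).Γ (M i).k₁ → QSymb) {r : Reg} (hr : .tmp ≠ r)
    (o : Reg → List QSymb) (ho : o .tmp = []) (l : List Bool) (T : ∀ i k, List ((M i).Γ k))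
    {L : List ((M i).Γ (M i).k₁)} (hT : T i = update (fun _ => []) (M i).k₁ L) :
    (fetch i d r).Runs (allStacks M o l T)
      (allStacks M (update o r (L.map d ++ o r)) l (update T i fun _ => []))
      (4 * L.length + 2) := by
  have key : ∀ (L : List ((M i).Γ (M i).k₁)) (o : Reg → List QSymb) (T : ∀ i k, List ((M i).Γ k)),
      T i = update (fun _ => []) (M i).k₁ L →
      (Frag.loop (.inr ⟨i, (M i).k₁⟩) d fun s => .push (.inl (some .tmp)) s : MainFrag M).Runs
        (allStacks M o l T)
        (allStacks M (update o .tmp ((L.map d).reverse ++ o .tmp)) l (update T i fun _ => []))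
        (2 * L.length + 1) := by
    intro L
    induction L with
    | nil =>
      intro o T hT
      have hT' : (update T i fun _ => []) = T := by
        have : update (fun _ => []) (M i).k₁ [] = (fun k => [] : ∀ k, List ((M i).Γ k)) := by simp
        rw [← this, ← hT]; simp
      simp only [List.map_nil, List.reverse_nil, List.nil_append, update_eq_self, hT']
      exact Frag.runs_loop_nil (show T i (M i).k₁ = [] by rw [hT]; simp)
    | cons a L ih =>
      intro o T hT
      have h₁ := Frag.runs_push (σ := JointState QSymb M) (.inl (some .tmp)) (d a)
        (allStacks M o l (update T i (update (T i) (M i).k₁ L)))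
      rw [update_jointStacks_inl, update_mainStacks_some] at h₁
      have h₂ := ih (update o .tmp (d a :: o .tmp)) (update T i (update (T i) (M i).k₁ L))
        (by simp [hT])
      refine (Frag.runs_loop_cons (Γ := JointAlphabet MainAlphabet M)
        (k := Sum.inr (⟨i, (M i).k₁⟩ : Σ i, (M i).K)) (S := allStacks M o l T) (x := a)
        (l := L) (t := 1) (show T i (M i).k₁ = a :: L by rw [hT]; simp) ?_ h₂).congr ?_ (by simp; omega)
      · rw [update_jointStacks_inr]; exact h₁
      · simp
  have h₂ := (Prog.exec_move hr (update o .tmp ((L.map d).reverse ++ o .tmp))).runs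
    (M := M) l (update T i fun _ => [])
  refine ((key L o T hT).seq h₂).congr ?_ (by simp [ho]; omega)
  · refine congrArg (fun o => allStacks M o l _) ?_
    funext x
    by_cases hx : x = r
    · subst hx; simp [hr.symm, ho]
    · by_cases hx' : x = .tmp
      · subst hx'; simp [hr, ho]
      · simp [hx, hx']

end

/-! ### Printable families -/

/-- Functions that are bounded by a polynomial. -/
def PolyBounded (f : ℕ → ℕ) : Prop := ∃ p : Polynomial ℕ, ∀ n, f n ≤ p.eval n

theorem PolyBounded.mono {f g : ℕ → ℕ} (hg : PolyBounded g) (h : ∀ n, f n ≤ g n) :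
    PolyBounded f :=
  let ⟨p, hp⟩ := hg
  ⟨p, fun n => (h n).trans (hp n)⟩

theorem PolyBounded.const (c : ℕ) : PolyBounded fun _ => c := ⟨.C c, fun n => by simp⟩

theorem PolyBounded.id : PolyBounded fun n => n := ⟨.X, fun n => by simp⟩

theorem PolyBounded.eval (p : Polynomial ℕ) : PolyBounded fun n => p.eval n := ⟨p, fun _ => le_rfl⟩

theorem PolyBounded.add {f g : ℕ → ℕ} (hf : PolyBounded f) (hg : PolyBounded g) :
    PolyBounded fun n => f n + g n :=
  let ⟨p, hp⟩ := hf
  let ⟨q, hq⟩ := hg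
  ⟨p + q, fun n => by simpa using add_le_add (hp n) (hq n)⟩

theorem PolyBounded.mul {f g : ℕ → ℕ} (hf : PolyBounded f) (hg : PolyBounded g) :
    PolyBounded fun n => f n * g n :=
  let ⟨p, hp⟩ := hf
  let ⟨q, hq⟩ := hg
  ⟨p * q, fun n => by simpa using Nat.mul_le_mul (hp n) (hq n)⟩

theorem initList_stk (tm : FinTM2) (s : List (tm.Γ tm.k₀)) :
    (initList tm s).stk = update (fun _ => []) tm.k₀ s := by
  funext k
  by_cases h : k = tm.k₀
  · subst h; simp [initList]
  · simp [initList, h]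

theorem haltList_stk (tm : FinTM2) (s : List (tm.Γ tm.k₁)) :
    (haltList tm s).stk = update (fun _ => []) tm.k₁ s := by
  funext k
  by_cases h : k = tm.k₁
  · subst h; simp [haltList]
  · simp [haltList, h]

theorem unaryEncodeNat_eq (n : ℕ) : Computability.unaryEncodeNat n = List.replicate n true := by
  induction n with
  | zero => rfl
  | succ n ih => rw [Computability.unaryEncodeNat, ih, List.replicate_succ]

/-- A polynomial-time machine that prints a family of words, unfolded. -/
theorem PolyTimePrintable.exists_machine {S : Type} {w : ℕ → List S} (hw : PolyTimePrintable w) :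
    ∃ (tm : FinTM2) (x : tm.Γ tm.k₀) (e : tm.Γ tm.k₁ ≃ S) (p : Polynomial ℕ), ∀ n,
      ∃ t ≤ p.eval n, Steps tm.m t
        ⟨some tm.main, tm.initialState, update (fun _ => []) tm.k₀ (List.replicate n x)⟩
        ⟨none, tm.initialState, update (fun _ => []) tm.k₁ ((w n).map e.symm)⟩ := by
  obtain ⟨⟨⟨tm, ei, eo⟩, p, h⟩⟩ := hw
  refine ⟨tm, ei.symm true, eo, p, fun n => ?_⟩
  have hl : (Computability.unaryEncodeNat n).length = n := by rw [unaryEncodeNat_eq]; simp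
  obtain ⟨⟨t, ht⟩, htp⟩ := h n
  rw [hl] at htp
  refine ⟨t, htp, ?_⟩
  have := steps_iff.2 ht
  have hi : (List.map ei.invFun (Computability.unaryEncodeNat n)) =
      List.replicate n (ei.symm true) := by
    rw [unaryEncodeNat_eq, List.map_replicate]; rfl
  rw [hi] at this
  rw [← initList_stk, ← haltList_stk]
  exact this

/-- A machine with finitely many labels pushes boundedly many symbols per step, so polynomial time
bounds the output. This makes program costs, stated in terms of word lengths, polynomial in `n`. -/
theorem PolyTimePrintable.length_polyBounded {S : Type} {w : ℕ → List S}
    (hw : PolyTimePrintable w) : PolyBounded fun n => (w n).length := by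
  obtain ⟨tm, x, e, p, h⟩ := hw.exists_machine
  let _ := tm.ΛFin
  refine (((PolyBounded.const (∑ l, pushCount (tm.m l))).mul (.eval p)).add .id).mono fun n => ?_
  obtain ⟨t, ht, hs⟩ := h n
  have h₁ := hs.length_le (B := ∑ l, pushCount (tm.m l))
    (fun l => Finset.single_le_sum (f := fun l => pushCount (tm.m l))
      (fun _ _ => Nat.zero_le _) (Finset.mem_univ l)) tm.k₁
  -- Input and output stack may coincide, so the output stack may start with up to `n` symbols.
  have h₂ := length_update_le (fun _ => []) tm.k₀ tm.k₁ (List.replicate n x) n (by simp)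
  simp only [update_self, List.length_map] at h₁
  have h₃ := Nat.mul_le_mul_left (∑ l, pushCount (tm.m l)) ht
  simp only [List.length_nil] at h₂
  omega

/-- Words that a program computes from two printable words are printable. -/
theorem PolyTimePrintable.of_exec {u v w : ℕ → List QSymb} (hu : PolyTimePrintable u)
    (hv : PolyTimePrintable v) (P : Prog) {cost : ℕ → ℕ} (hcost : PolyBounded cost)
    (hP : ∀ n, P.Exec (regs [] (u n) (v n) [] []) (regs (w n) [] [] [] []) (cost n)) :
    PolyTimePrintable w := by
  let W : Bool → ℕ → List QSymb := fun i => cond i v u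
  have hW : ∀ i, PolyTimePrintable (W i) := by rintro (_ | _) <;> assumption
  choose M x e p hM using fun i => (hW i).exists_machine
  -- Reading the unary input consumes it, so both machines receive their copy before either runs.
  let F : MainFrag M := .seq (feed x) (.seq (.call M false) (.seq (fetch false (e false) .fst)
    (.seq (.call M true) (.seq (fetch true (e true) .snd) (P.toFrag M)))))
  let s₀ : JointState QSymb M := (none, fun i => (M i).initialState)
  -- `haltList` prescribes the initial internal state as well as the stacks, so one last step
  -- restores it.
  let R : MainFrag M := .single (.load (fun _ => s₀) .halt)
  have hF : ∀ n, F.Runs (allStacks M (fun _ => []) (List.replicate n true) (feedStacks x 0))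
      (allStacks M (regs (w n) [] [] [] []) [] fun _ _ => [])
      (3 * n + 1 + (1 + (p false).eval n + (4 * (u n).length + 2 + (1 + (p true).eval n +
        (4 * (v n).length + 2 + cost n))))) := by
    intro n
    obtain ⟨t₁, ht₁, h₁⟩ := hM false n
    obtain ⟨t₂, ht₂, h₂⟩ := hM true n
    have f := runs_feed x (fun _ => []) (List.replicate n true) 0
    have c₁ := (Frag.runs_call (A := QSymb) h₁ (mainStacks (fun _ => []) [])
      (feedStacks x n) rfl).mono (Nat.add_le_add_left ht₁ 1)
    have g₁ := runs_fetch (M := M) (e false) (r := .fst) (by decide) (fun _ => []) rfl []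
      (update (feedStacks x n) false (update (fun _ => []) (M false).k₁
        ((W false n).map (e false).symm))) (update_self ..)
    have c₂ := (Frag.runs_call (A := QSymb) h₂
      (mainStacks (update (fun _ => []) .fst (u n)) [])
      (update (feedStacks x n) false fun _ => []) (by simp [feedStacks])).mono
      (Nat.add_le_add_left ht₂ 1)
    have g₂ := runs_fetch (M := M) (e true) (r := .snd) (by decide)
      (update (fun _ => []) .fst (u n)) (by simp) []
      (update (update (feedStacks x n) false fun _ => []) true (update (fun _ => []) (M true).k₁
        ((W true n).map (e true).symm))) (update_self ..)
    have hT : (update (update (feedStacks x n) false fun _ => []) true fun _ => []) =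
        fun i k => ([] : List ((M i).Γ k)) := by
      funext i; cases i <;> simp
    have hr : update (update (fun _ => []) Reg.fst (u n)) Reg.snd (v n) =
        regs [] (u n) (v n) [] [] := by
      funext r; cases r <;> simp [regs]
    simp only [List.length_replicate, zero_add] at f
    simp only [update_idem, List.map_map, Equiv.self_comp_symm, List.map_id, List.append_nil,
      List.length_map, W, cond_false] at g₁
    simp only [update_idem, List.map_map, Equiv.self_comp_symm, List.map_id, List.append_nil,
      List.length_map, W, cond_true, ne_eq, reduceCtorEq, not_false_eq_true, update_of_ne, hT,
      hr] at g₂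
    exact f.seq (c₁.seq (g₁.seq (c₂.seq (g₂.seq ((hP n).runs [] _)))))
  have hcost' : PolyBounded fun n => (3 * n + 1 + (1 + (p false).eval n + (4 * (u n).length + 2 +
      (1 + (p true).eval n + (4 * (v n).length + 2 + cost n))))) + 1 :=
    (((((PolyBounded.const 3).mul .id).add (.const 1)).add (((PolyBounded.const 1).add
      (.eval _)).add ((((PolyBounded.const 4).mul hu.length_polyBounded).add (.const 2)).add
      (((PolyBounded.const 1).add (.eval _)).add ((((PolyBounded.const 4).mul
      hv.length_polyBounded).add (.const 2)).add hcost))))).add (.const 1))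
  obtain ⟨q, hq⟩ := hcost'
  let _ := fun i => (M i).kFin
  let _ := fun i => (M i).σFin
  let _ := (F.seq R).fin
  let tm : FinTM2 :=
    { K := Option Reg ⊕ (Σ i, (M i).K)
      k₀ := .inl none
      k₁ := .inl (some .out)
      Γ := JointAlphabet MainAlphabet M
      Λ := (F.seq R).Λ
      main := (F.seq R).main
      σ := JointState QSymb M
      initialState := s₀
      Γk₀Fin := inferInstanceAs (Fintype Bool)
      m := (F.seq R).m }
  have key : ∀ n, ∃ t ≤ q.eval n, Steps tm.m t (initList tm (List.replicate n true))
      (haltList tm (w n)) := by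
    intro n
    obtain ⟨v', t, ht, hs⟩ := hF n s₀
    refine ⟨t + 1, (Nat.add_le_add_right ht 1).trans (hq n), ?_⟩
    have hi : (initList tm (List.replicate n true)).stk =
        allStacks M (fun _ => []) (List.replicate n true) (feedStacks x 0) := by
      rw [initList_stk]
      funext k
      rcases k with (_ | r) | ⟨i, k⟩
      · exact update_self ..
      · exact update_of_ne (by simp [tm]) ..
      · refine (update_of_ne (by simp [tm]) ..).trans ?_
        simp [feedStacks]
    have hh : (haltList tm (w n)).stk =
        allStacks M (regs (w n) [] [] [] []) [] fun _ _ => [] := by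
      rw [haltList_stk]
      funext k
      rcases k with (_ | r) | ⟨i, k⟩
      · exact update_of_ne (by simp [tm]) ..
      · cases r
        case out => exact update_self ..
        all_goals exact update_of_ne (by simp [tm]) ..
      · exact update_of_ne (by simp [tm]) ..
    have := Frag.steps_seq hs (Frag.steps_single (.load (fun _ => s₀) .halt) v' _)
    rw [← hi] at this
    refine Eq.mp ?_ this
    congr 1
    exact congrArg (TM2.Cfg.mk none s₀) hh.symm
  choose t ht hs using key
  have hl : ∀ n, (Computability.unaryEncodeNat n).length = n := fun n => by
    rw [unaryEncodeNat_eq]; simp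
  refine ⟨⟨⟨tm, Equiv.refl Bool, Equiv.refl QSymb⟩, q, fun n => ⟨⟨t n, ?_⟩, ?_⟩⟩⟩
  · have := steps_iff.1 (hs n)
    rw [← unaryEncodeNat_eq] at this
    refine Eq.trans ?_ (this.trans ?_)
    · congr 2
      exact congrArg (initList tm) (List.map_id _)
    · exact congrArg some (congrArg (haltList tm) (List.map_id _).symm)
  · rw [hl]
    exact ht n

/-! ### Printable words -/

section

variable (o f s t c l : List QSymb)

@[simp] theorem update_regs_out : update (regs o f s t c) .out l = regs l f s t c := by
  funext r; cases r <;> rfl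

@[simp] theorem update_regs_fst : update (regs o f s t c) .fst l = regs o l s t c := by
  funext r; cases r <;> rfl

@[simp] theorem update_regs_snd : update (regs o f s t c) .snd l = regs o f l t c := by
  funext r; cases r <;> rfl

@[simp] theorem update_regs_tmp : update (regs o f s t c) .tmp l = regs o f s l c := by
  funext r; cases r <;> rfl

@[simp] theorem update_regs_cnt : update (regs o f s t c) .cnt l = regs o f s t l := by
  funext r; cases r <;> rfl

end

/-- Empty a register. -/
def Prog.clear (r : Reg) : Prog := .loop r fun _ => .skip

theorem Prog.exec_clear (r : Reg) (o : Reg → List QSymb) :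
    (Prog.clear r).Exec o (update o r []) (2 * (o r).length + 1) := by
  induction hl : o r generalizing o with
  | nil =>
    have : update o r [] = o := by rw [← hl]; simp
    rw [this]
    exact Exec.loopNil hl
  | cons s l ih =>
    refine (Exec.loopCons hl (Exec.skip _) (ih (update o r l) (by simp))).congr (by simp) ?_
    simp; omega

/-- Words grow at the head, so the second one is written first. Passing through `tmp` restores the
order of each. -/
theorem PolyTimePrintable.append {u v : ℕ → List QSymb} (hu : PolyTimePrintable u)
    (hv : PolyTimePrintable v) : PolyTimePrintable fun n => u n ++ v n := by
  refine hu.of_exec hv (.seq (.move .snd .tmp) (.seq (.move .tmp .out)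
    (.seq (.move .fst .tmp) (.move .tmp .out))))
    (cost := fun n => 4 * (u n).length + 4 * (v n).length + 4) ?_ fun n => ?_
  · exact (((PolyBounded.const 4).mul hu.length_polyBounded).add
      ((PolyBounded.const 4).mul hv.length_polyBounded)).add (.const 4)
  · have h₁ := Prog.exec_move (r := .snd) (r' := .tmp) (by decide) (regs [] (u n) (v n) [] [])
    have h₂ := Prog.exec_move (r := .tmp) (r' := .out) (by decide)
      (regs [] (u n) [] (v n).reverse [])
    have h₃ := Prog.exec_move (r := .fst) (r' := .tmp) (by decide) (regs (v n) (u n) [] [] [])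
    have h₄ := Prog.exec_move (r := .tmp) (r' := .out) (by decide)
      (regs (v n) [] [] (u n).reverse [])
    simp only [regs, update_regs_out, update_regs_fst, update_regs_snd, update_regs_tmp,
      List.append_nil, List.reverse_reverse, List.length_reverse] at h₁ h₂ h₃ h₄
    exact (h₁.seq (h₂.seq (h₃.seq h₄))).mono (by omega)

/-- The number of wires after a word has been read as the description of a circuit, starting with
`n` wires. -/
def wireCount : List QSymb → ℕ → ℕ
  | [], n => n
  | .anc :: w, n => wireCount w (n + 1)
  | .disc :: w, n => wireCount w (n - 1)
  | _ :: w, n => wireCount w n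

/-- `out` serves as a unary counter while the description is read. Dropping from an empty stack does
nothing, in agreement with the truncated `n - 1`. -/
theorem PolyTimePrintable.wireCount {u : ℕ → List QSymb} (hu : PolyTimePrintable u) :
    PolyTimePrintable fun n => List.replicate (wireCount (u n) 0) QSymb.tick := by
  let body : QSymb → Prog
    | .anc => .push .out .tick
    | .disc => .drop .out
    | _ => .skip
  have key : ∀ (w v : List QSymb) (m : ℕ), (Prog.loop .fst body).Exec
      (regs (List.replicate m .tick) w v [] [])
      (regs (List.replicate (QCrypt.wireCount w m) .tick) [] v [] []) (2 * w.length + 1) := by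
    intro w v
    induction w with
    | nil => exact fun m => .loopNil rfl
    | cons s w ih =>
      intro m
      have h : ∃ m', QCrypt.wireCount (s :: w) m = QCrypt.wireCount w m' ∧
          (body s).Exec (regs (List.replicate m .tick) w v [] [])
            (regs (List.replicate m' .tick) w v [] []) 1 := by
        cases s
        case anc =>
          have := Prog.Exec.push .out .tick (regs (List.replicate m .tick) w v [] [])
          rw [update_regs_out] at this
          exact ⟨m + 1, rfl, this⟩
        case disc =>
          have := Prog.Exec.drop .out (regs (List.replicate m .tick) w v [] [])
          rw [update_regs_out] at this
          exact ⟨m - 1, rfl, by simpa [regs] using this⟩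
        all_goals exact ⟨m, rfl, .skip _⟩
      obtain ⟨m', hm', hb⟩ := h
      rw [hm']
      refine (Prog.Exec.loopCons (s := s) (l := w) (t := 1) rfl ?_ (ih m')).mono ?_
      · rw [update_regs_fst]; exact hb
      · simp; omega
  -- Only one input word is needed; the second copy is erased, since every stack but the output must
  -- end empty.
  refine hu.of_exec hu (.seq (.loop .fst body) (.clear .snd))
    (cost := fun n => 4 * (u n).length + 2) ?_ fun n => ?_
  · exact ((PolyBounded.const 4).mul hu.length_polyBounded).add (.const 2)
  · refine ((key (u n) (u n) 0).seq (Prog.exec_clear _ _)).congr ?_ ?_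
    · simp
    · simp [regs]; omega

/-- Write a fixed word. -/
def Prog.write : List QSymb → Prog
  | [] => .skip
  | s :: w => .seq (.write w) (.push .out s)

theorem Prog.exec_write (w o f s t c : List QSymb) :
    (Prog.write w).Exec (regs o f s t c) (regs (w ++ o) f s t c) (w.length + 1) := by
  induction w with
  | nil => exact .skip _
  | cons a w ih =>
    have := Exec.push .out a (regs (w ++ o) f s t c)
    rw [update_regs_out] at this
    exact ih.seq this

theorem PolyTimePrintable.flatten_replicate {k : ℕ → ℕ}
    (hk : PolyTimePrintable fun n => List.replicate (k n) QSymb.tick) (w : List QSymb) :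
    PolyTimePrintable fun n => (List.replicate (k n) w).flatten := by
  have key : ∀ (k m : ℕ) (v : List QSymb), (Prog.loop .fst fun _ => .write w).Exec
      (regs (List.replicate m w).flatten (List.replicate k .tick) v [] [])
      (regs (List.replicate (m + k) w).flatten [] v [] []) ((w.length + 2) * k + 1) := by
    intro k
    induction k with
    | zero => exact fun m v => .loopNil rfl
    | succ k ih =>
      intro m v
      have hb := Prog.exec_write w (List.replicate m w).flatten (List.replicate k .tick) v [] []
      have hl := ih (m + 1) v
      rw [List.replicate_succ, List.flatten_cons] at hl
      refine (Prog.Exec.loopCons (s := .tick) (l := List.replicate k .tick) (t := w.length + 1) rfl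
        ?_ hl).congr ?_ ?_
      · rw [update_regs_fst]; exact hb
      · rw [Nat.add_right_comm, Nat.add_assoc]
      · rw [Nat.mul_add]; omega
  have hl : PolyBounded k := hk.length_polyBounded.mono fun n => by simp
  refine hk.of_exec hk (.seq (.loop .fst fun _ => .write w) (.clear .snd))
    (cost := fun n => ((w.length + 2) * k n + 1) + (2 * k n + 1)) ?_ fun n => ?_
  · exact (((PolyBounded.const _).mul hl).add (.const 1)).add
      (((PolyBounded.const 2).mul hl).add (.const 1))
  · refine ((key (k n) 0 (List.replicate (k n) .tick)).seq (Prog.exec_clear _ _)).congr ?_ ?_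
    · simp
    · simp [regs]

/-- Copy a register to the output. -/
def Prog.copy (r : Reg) : Prog :=
  .seq (.loop r fun s => .seq (.push .tmp s) (.push .out s)) (.move .tmp r)

/-- The loop empties `r`, and the second copy in `tmp` restores it. The copy in `out` is reversed,
which is harmless for the unary counters it is used on. -/
theorem Prog.exec_copy {r : Reg} (hr : r ≠ .out) (hr' : r ≠ .tmp) (o : Reg → List QSymb)
    (ho : o .tmp = []) :
    (Prog.copy r).Exec o (update o .out ((o r).reverse ++ o .out)) (5 * (o r).length + 2) := by
  have key : ∀ (w : List QSymb) (o : Reg → List QSymb), o r = w →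
      (Prog.loop r fun s => .seq (.push .tmp s) (.push .out s)).Exec o
        (update (update (update o r []) .tmp (w.reverse ++ o .tmp)) .out (w.reverse ++ o .out))
        (3 * w.length + 1) := by
    intro w
    induction w with
    | nil =>
      intro o hw
      have : update (update (update o r []) .tmp (o .tmp)) .out (o .out) = o := by
        rw [← hw]; simp
      simp only [List.reverse_nil, List.nil_append, this]
      exact .loopNil hw
    | cons s w ih =>
      intro o hw
      refine (Exec.loopCons hw ((Exec.push _ _ _).seq (Exec.push _ _ _)) (ih _ ?_)).congr ?_ ?_
      · simp [hr, hr']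
      · funext x
        by_cases h₁ : x = .out
        · subst h₁; simp [hr.symm]
        · by_cases h₂ : x = .tmp
          · subst h₂; simp [hr'.symm]
          · by_cases h₃ : x = r
            · subst h₃; simp [h₁, h₂]
            · simp [h₁, h₂, h₃]
      · simp; omega
  refine ((key (o r) o rfl).seq (Prog.exec_move hr'.symm _)).congr ?_ ?_
  · funext x
    by_cases h₁ : x = .out
    · subst h₁; simp [hr.symm]
    · by_cases h₂ : x = .tmp
      · subst h₂; simp [hr'.symm, ho]
      · by_cases h₃ : x = r
        · subst h₃; simp [h₁, h₂, ho]
        · simp [h₁, h₂, h₃]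
  · simp [ho]; omega

/-! ### Printing the description of the one-time pad -/

/-- The description of the gates that apply `X ^ a * Z ^ z` to wire `j`, where `a` and `z` are
the values of the wires `c` and `c + 1`. -/
def padBlock (j c : ℕ) : List QSymb :=
  .had :: (List.replicate j .tick ++ .cnot :: (List.replicate (c + 1) .tick ++ .sep ::
    (List.replicate j .tick ++ .had :: (List.replicate j .tick ++ .cnot ::
      (List.replicate c .tick ++ .sep :: List.replicate j .tick)))))

/-- The description of the one-time pad on the first `k` wires, with the key on the `2 * k` wires
from wire `c` on. -/
def padWord : ℕ → ℕ → List QSymb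
  | 0, _ => []
  | k + 1, c => padBlock k (c + 2 * k) ++ padWord k c

/-- A program that writes a block of the description of the one-time pad. -/
def Prog.padBlock : Prog :=
  .seq (.copy .cnt) <| .seq (.push .out .sep) <| .seq (.copy .snd) <| .seq (.push .out .cnot) <|
  .seq (.copy .cnt) <| .seq (.push .out .had) <| .seq (.copy .cnt) <| .seq (.push .out .sep) <|
  .seq (.push .snd .tick) <| .seq (.copy .snd) <| .seq (.push .out .cnot) <|
  .seq (.copy .cnt) <| .seq (.push .out .had) <| .seq (.push .snd .tick) (.push .cnt .tick)

/-- The block is written from its last symbol to its first, with the target wire in `cnt` and the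
key wire in `snd`. The first increment of `snd` gives the control `c + 1`; the second, with that of
`cnt`, prepares the next block. -/
theorem Prog.exec_padBlock (o f : List QSymb) (j c : ℕ) :
    Prog.padBlock.Exec (regs o f (List.replicate c .tick) [] (List.replicate j .tick))
      (regs (QCrypt.padBlock j c ++ o) f (List.replicate (c + 2) .tick) []
        (List.replicate (j + 1) .tick)) (20 * j + 10 * c + 26) := by
  have hc : ∀ o j c, (Prog.copy .cnt).Exec
      (regs o f (List.replicate c .tick) [] (List.replicate j .tick))
      (regs (List.replicate j .tick ++ o) f (List.replicate c .tick) [] (List.replicate j .tick))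
      (5 * j + 2) := fun o j c => by
    simpa [regs] using Prog.exec_copy (r := .cnt) (by decide) (by decide)
      (regs o f (List.replicate c .tick) [] (List.replicate j .tick)) rfl
  have hs : ∀ o j c, (Prog.copy .snd).Exec
      (regs o f (List.replicate c .tick) [] (List.replicate j .tick))
      (regs (List.replicate c .tick ++ o) f (List.replicate c .tick) [] (List.replicate j .tick))
      (5 * c + 2) := fun o j c => by
    simpa [regs] using Prog.exec_copy (r := .snd) (by decide) (by decide)
      (regs o f (List.replicate c .tick) [] (List.replicate j .tick)) rfl
  have hp : ∀ a o j c, (Prog.push .out a).Exec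
      (regs o f (List.replicate c .tick) [] (List.replicate j .tick))
      (regs (a :: o) f (List.replicate c .tick) [] (List.replicate j .tick)) 1 :=
    fun a o j c => by
      simpa [regs] using Exec.push .out a
        (regs o f (List.replicate c .tick) [] (List.replicate j .tick))
  have hsp : ∀ o j c, (Prog.push .snd .tick).Exec
      (regs o f (List.replicate c .tick) [] (List.replicate j .tick))
      (regs o f (List.replicate (c + 1) .tick) [] (List.replicate j .tick)) 1 := fun o j c => by
    simpa [regs, List.replicate_succ] using Exec.push .snd .tick
      (regs o f (List.replicate c .tick) [] (List.replicate j .tick))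
  have hcp : ∀ o j c, (Prog.push .cnt .tick).Exec
      (regs o f (List.replicate c .tick) [] (List.replicate j .tick))
      (regs o f (List.replicate c .tick) [] (List.replicate (j + 1) .tick)) 1 := fun o j c => by
    simpa [regs, List.replicate_succ] using Exec.push .cnt .tick
      (regs o f (List.replicate c .tick) [] (List.replicate j .tick))
  refine (Exec.seq (hc ..) <| Exec.seq (hp ..) <| Exec.seq (hs ..) <| Exec.seq (hp ..) <|
    Exec.seq (hc ..) <| Exec.seq (hp ..) <| Exec.seq (hc ..) <| Exec.seq (hp ..) <|
    Exec.seq (hsp ..) <| Exec.seq (hs ..) <| Exec.seq (hp ..) <| Exec.seq (hc ..) <|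
    Exec.seq (hp ..) <| Exec.seq (hsp ..) (hcp ..)).congr ?_ ?_
  · simp [QCrypt.padBlock]
  · omega

theorem PolyTimePrintable.padWord {k c : ℕ → ℕ}
    (hk : PolyTimePrintable fun n => List.replicate (k n) QSymb.tick)
    (hc : PolyTimePrintable fun n => List.replicate (c n) QSymb.tick) :
    PolyTimePrintable fun n => padWord (k n) (c n) := by
  -- `B` dominates the cost of each remaining iteration: the block on wires below `j + k`, plus one
  -- step for the pop.
  have key : ∀ k j c B : ℕ, 20 * (j + k) + 10 * (c + 2 * (j + k)) + 27 ≤ B →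
      (Prog.loop .fst fun _ => .padBlock).Exec
        (regs (QCrypt.padWord j c) (List.replicate k .tick) (List.replicate (c + 2 * j) .tick) []
          (List.replicate j .tick))
        (regs (QCrypt.padWord (j + k) c) [] (List.replicate (c + 2 * (j + k)) .tick) []
          (List.replicate (j + k) .tick)) (B * k + 1) := by
    intro k
    induction k with
    | zero => exact fun j c B hB => .loopNil rfl
    | succ k ih =>
      intro j c B hB
      have hb := Prog.exec_padBlock (QCrypt.padWord j c) (List.replicate k .tick) j (c + 2 * j)
      have hl := ih (j + 1) c B (by omega)
      rw [Nat.add_right_comm j 1 k, Nat.add_assoc j k 1] at hl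
      refine (Prog.Exec.loopCons (s := .tick) (l := List.replicate k .tick)
        (t := 20 * j + 10 * (c + 2 * j) + 26) rfl ?_ hl).mono ?_
      · rw [update_regs_fst]; exact hb
      · rw [Nat.mul_add_one]; omega
  have hk' : PolyBounded k := hk.length_polyBounded.mono fun n => by simp
  have hc' : PolyBounded c := hc.length_polyBounded.mono fun n => by simp
  refine hk.of_exec hc (.seq (.loop .fst fun _ => .padBlock) (.seq (.clear .snd) (.clear .cnt)))
    (cost := fun n => ((40 * k n + 10 * c n + 27) * k n + 1) + (6 * k n + 2 * c n + 2)) ?_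
    fun n => ?_
  · exact (((((PolyBounded.const 40).mul hk').add ((PolyBounded.const 10).mul hc')).add
      (.const 27)).mul hk' |>.add (.const 1)).add
      ((((PolyBounded.const 6).mul hk').add ((PolyBounded.const 2).mul hc')).add (.const 2))
  · have h := key (k n) 0 (c n) (40 * k n + 10 * c n + 27) (by omega)
    simp only [zero_add, Nat.mul_zero, Nat.add_zero] at h
    refine (h.seq ((Prog.exec_clear _ _).seq (Prog.exec_clear _ _))).congr ?_ ?_
    · simp
    · simp [regs]; omega

/-! ### Product operators -/

section Tens

variable {n c N : ℕ}

/-- The first `n` bits. -/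
def lowBits (e : n + c = N) (x : Bits N) : Bits n := fun i => x (Fin.cast e (Fin.castAdd c i))

/-- The last `c` bits. -/
def highBits (e : n + c = N) (x : Bits N) : Bits c := fun i => x (Fin.cast e (Fin.natAdd n i))

/-- The tensor product, on a register of `N = n + c` wires. -/
noncomputable def tens (e : n + c = N) (ρ : Op n) (τ : Op c) : Op N :=
  Matrix.of fun x y => ρ (lowBits e x) (lowBits e y) * τ (highBits e x) (highBits e y)

/-- Carrying the equation `n + c = N` in `tens` lets wire counts such as `n + 1 + c` and `n + c + 1`
be identified without casting operators. -/
theorem tensor_eq_tens (ρ : Op n) (τ : Op c) : tensor ρ τ = tens rfl ρ τ := rfl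

theorem tens_apply (e : n + c = N) (ρ : Op n) (τ : Op c) (x y : Bits N) :
    tens e ρ τ x y = ρ (lowBits e x) (lowBits e y) * τ (highBits e x) (highBits e y) := rfl

theorem bits_ext (e : n + c = N) {x y : Bits N} (hl : lowBits e x = lowBits e y)
    (hh : highBits e x = highBits e y) : x = y := by
  subst e
  funext i
  refine Fin.addCases (fun i => ?_) (fun i => ?_) i
  · exact congrFun hl i
  · exact congrFun hh i

theorem tens_mul (e : n + c = N) (A C : Op n) (B D : Op c) :
    tens e A B * tens e C D = tens e (A * C) (B * D) := by
  subst e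
  simp only [← tensor_eq_tens, tensor, Matrix.reindex_apply, Matrix.submatrix_mul_equiv,
    Matrix.mul_kronecker_mul]

theorem tens_conjTranspose (e : n + c = N) (A : Op n) (B : Op c) :
    (tens e A B).conjTranspose = tens e A.conjTranspose B.conjTranspose := by
  ext x y
  simp [tens_apply, Matrix.conjTranspose_apply, mul_comm]

theorem tens_one (e : n + c = N) : tens e (1 : Op n) (1 : Op c) = 1 := by
  ext x y
  rw [tens_apply]
  by_cases h : x = y
  · subst h; simp
  · rw [Matrix.one_apply_ne h]
    by_cases hl : lowBits e x = lowBits e y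
    · rw [Matrix.one_apply_ne (fun hh => h (bits_ext e hl hh)), mul_zero]
    · rw [Matrix.one_apply_ne hl, zero_mul]

theorem tens_zero_left (e : 0 + c = c) (τ : Op c) : tens e 1 τ = τ := by
  ext x y
  have h : ∀ x, highBits e x = x := fun x => funext fun i => congrArg x (Fin.ext (by simp))
  rw [tens_apply, h, h, Subsingleton.elim (lowBits e x) (lowBits e y)]
  simp

theorem onWire_tens (e : n + c = N) (i : Fin n) (U : Matrix Bool Bool ℂ) :
    onWire (Fin.cast e (Fin.castAdd c i)) U = tens e (onWire i U) 1 := by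
  ext x y
  subst e
  simp only [onWire, tens_apply, Matrix.of_apply, Matrix.one_apply, mul_ite, mul_one, mul_zero,
    ← ite_and]
  refine ite_congr ?_ (fun _ => rfl) fun _ => rfl
  refine propext ⟨fun h => ⟨?_, ?_⟩, fun h => ?_⟩
  · exact funext fun j => h _ (by simp [Fin.ext_iff]; omega)
  · exact fun j hj => h _ (by simpa [Fin.ext_iff] using hj)
  · intro j
    refine Fin.addCases (fun j hj => ?_) (fun j hj => ?_) j
    · exact h.2 j (by simpa [Fin.ext_iff] using hj)
    · exact congrFun h.1 j

/-- Row `x` of `onWire i U` is supported on the two strings that agree with `x` off wire `i`. -/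
theorem onWire_mul_apply (i : Fin n) (U : Matrix Bool Bool ℂ) (ρ : Op n) (x y : Bits n) :
    (onWire i U * ρ) x y = ∑ b, U (x i) b * ρ (update x i b) y := by
  rw [Matrix.mul_apply]
  refine (Finset.sum_of_injOn (fun b => update x i b) ?_ ?_ ?_ ?_).symm
  · exact fun a _ b _ h => by simpa using congrFun h i
  · exact fun _ _ => Finset.mem_coe.2 (Finset.mem_univ _)
  · intro z _ hz
    have : ¬ ∀ j, j ≠ i → x j = z j := fun h => hz ⟨z i, by simp, by
      funext j
      by_cases hj : j = i
      · subst hj; simp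
      · simp [hj, h j hj]⟩
    simp [onWire, this]
  · intro b _
    have : ∀ j, j ≠ i → x j = update x i b j := fun j hj => by simp [hj]
    simp only [onWire, Matrix.of_apply, if_pos this, update_self]

theorem onWire_mul (i : Fin n) (U V : Matrix Bool Bool ℂ) :
    onWire i U * onWire i V = onWire i (U * V) := by
  ext x y
  rw [onWire_mul_apply]
  by_cases h : ∀ j, j ≠ i → x j = y j
  · have h' : ∀ b, ∀ j, j ≠ i → update x i b j = y j := fun b j hj => by simp [hj, h j hj]
    simp only [onWire, Matrix.of_apply, if_pos h, if_pos (h' _), Matrix.mul_apply, update_self]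
  · have h' : ∀ b, ¬ ∀ j, j ≠ i → update x i b j = y j := fun b hb => h fun j hj => by
      simpa [hj] using hb j hj
    simp [onWire, h, h']

theorem onWire_one (i : Fin n) : onWire i (1 : Matrix Bool Bool ℂ) = 1 := by
  ext x y
  by_cases h : x = y
  · subst h; simp [onWire]
  · rw [Matrix.one_apply_ne h]
    by_cases hi : x i = y i
    · have : ¬ ∀ j, j ≠ i → x j = y j := fun h' => h (funext fun j => by
        by_cases hj : j = i
        · subst hj; exact hi
        · exact h' j hj)
      simp [onWire, this]
    · simp [onWire, hi]

end Tens

/-! ### Circuits with additional wires -/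

section Extension

variable {n m c N M : ℕ}

theorem lowBits_update_low (e : n + c = N) (x : Bits N) (i : Fin n) (b : Bool) :
    lowBits e (update x (Fin.cast e (Fin.castAdd c i)) b) = update (lowBits e x) i b := by
  funext j
  by_cases h : j = i
  · subst h; simp [lowBits]
  · have h' : Fin.cast e (Fin.castAdd c j) ≠ Fin.cast e (Fin.castAdd c i) := by
      simpa [Fin.ext_iff] using h
    simp [lowBits, h, h']

theorem highBits_update_low (e : n + c = N) (x : Bits N) (i : Fin n) (b : Bool) :
    highBits e (update x (Fin.cast e (Fin.castAdd c i)) b) = highBits e x := by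
  funext j
  refine update_of_ne ?_ _ _
  simp [Fin.ext_iff]; omega

theorem lowBits_insertNth_low {k : ℕ} (e : n + 1 + c = k + 1) (e' : n + c = k) (i : Fin (n + 1))
    (b : Bool) (x : Bits k) :
    lowBits e (Fin.insertNth (α := fun _ => Bool) (Fin.cast e (Fin.castAdd c i)) b x) =
      Fin.insertNth (α := fun _ => Bool) i b (lowBits e' x) := by
  rw [Fin.eq_insertNth_iff]
  refine ⟨by simp [lowBits], funext fun j => ?_⟩
  have : Fin.cast e (Fin.castAdd c (i.succAbove j)) =
      (Fin.cast e (Fin.castAdd c i)).succAbove (Fin.cast e' (Fin.castAdd c j)) := by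
    ext; simp only [Fin.succAbove, Fin.lt_def]; simp; split_ifs <;> simp
  simp [Fin.removeNth, lowBits, this]

theorem highBits_insertNth_low {k : ℕ} (e : n + 1 + c = k + 1) (e' : n + c = k) (i : Fin (n + 1))
    (b : Bool) (x : Bits k) :
    highBits e (Fin.insertNth (α := fun _ => Bool) (Fin.cast e (Fin.castAdd c i)) b x) =
      highBits e' x := by
  funext j
  have : Fin.cast e (Fin.natAdd (n + 1) j) =
      (Fin.cast e (Fin.castAdd c i)).succAbove (Fin.cast e' (Fin.natAdd n j)) := by
    ext; simp only [Fin.succAbove, Fin.lt_def]; simp; split_ifs <;> simp <;> omega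
  simp [highBits, this]

/-- A gate can be applied in the presence of `c` further wires. -/
theorem QGate.exists_extend (g : QGate n m) (e : n + c = N) (e' : m + c = M) :
    ∃ g' : QGate N M, g'.encode = g.encode ∧
      ∀ (ρ : Op n) (τ : Op c), g'.apply (tens e ρ τ) = tens e' (g.apply ρ) τ := by
  have hU : ∀ (n : ℕ) (e : n + c = N) (i : Fin n) (U : Matrix Bool Bool ℂ) (ρ : Op n) (τ : Op c),
      onWire (Fin.cast e (Fin.castAdd c i)) U * tens e ρ τ *
        (onWire (Fin.cast e (Fin.castAdd c i)) U).conjTranspose =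
      tens e (onWire i U * ρ * (onWire i U).conjTranspose) τ := fun n e i U ρ τ => by
    rw [onWire_tens, tens_conjTranspose, tens_mul, tens_mul]; simp
  -- The further wires come last: new wires enter at index `0`, and the wires of `g` keep their
  -- numbers. The extended gate thus has the same description.
  cases g with
  | anc =>
    obtain rfl : M = N + 1 := by omega
    refine ⟨.anc, rfl, fun ρ τ => ?_⟩
    have h₀ : ∀ x : Bits (N + 1), lowBits e' x 0 = x 0 := fun x => rfl
    have hl : ∀ x : Bits (N + 1), Fin.tail (lowBits e' x) = lowBits e (Fin.tail x) := fun x =>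
      funext fun i => congrArg x (Fin.ext (by simp))
    have hh : ∀ x : Bits (N + 1), highBits e' x = highBits e (Fin.tail x) := fun x =>
      funext fun i => congrArg x (Fin.ext (by simp; omega))
    ext x y
    simp only [QGate.apply, Matrix.of_apply, tens_apply, h₀, hl, hh]
    split_ifs <;> simp
  | disc i =>
    obtain rfl : N = M + 1 := by omega
    refine ⟨.disc (Fin.cast e (Fin.castAdd c i)), rfl, fun ρ τ => ?_⟩
    ext x y
    simp only [QGate.apply, Matrix.of_apply, tens_apply, Finset.sum_mul]
    refine Finset.sum_congr rfl fun b _ => ?_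
    rw [lowBits_insertNth_low e e', lowBits_insertNth_low e e', highBits_insertNth_low e e',
      highBits_insertNth_low e e']
  | meas i =>
    obtain rfl : N = M := by omega
    refine ⟨.meas (Fin.cast e (Fin.castAdd c i)), rfl, fun ρ τ => ?_⟩
    ext x y
    simp only [QGate.apply, Matrix.of_apply, tens_apply, ite_mul, zero_mul]
    rfl
  | had i =>
    obtain rfl : N = M := by omega
    exact ⟨.had (Fin.cast e (Fin.castAdd c i)), rfl, hU n e i _⟩
  | tee i =>
    obtain rfl : N = M := by omega
    exact ⟨.tee (Fin.cast e (Fin.castAdd c i)), rfl, hU n e i _⟩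
  | cnot a t h =>
    obtain rfl : N = M := by omega
    refine ⟨.cnot (Fin.cast e (Fin.castAdd c a)) (Fin.cast e (Fin.castAdd c t))
      (by simpa [Fin.ext_iff] using h), rfl, fun ρ τ => ?_⟩
    ext x y
    simp only [QGate.apply, Matrix.submatrix_apply, tens_apply, lowBits_update_low,
      highBits_update_low]
    rfl

/-- A circuit can be applied in the presence of `c` further wires. -/
theorem QCircuit.exists_extend (C : QCircuit n m) (e : n + c = N) (e' : m + c = M) :
    ∃ C' : QCircuit N M, C'.encode = C.encode ∧
      ∀ (ρ : Op n) (τ : Op c), C'.apply (tens e ρ τ) = tens e' (C.apply ρ) τ := by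
  induction C generalizing N with
  | nil =>
    obtain rfl : N = M := by omega
    exact ⟨.nil, rfl, fun _ _ => rfl⟩
  | @cons n m p g C ih =>
    obtain ⟨C', hC, hC'⟩ := ih (N := m + c) rfl e'
    obtain ⟨g', hg, hg'⟩ := g.exists_extend e (M := m + c) rfl
    exact ⟨.cons g' C', by simp [QCircuit.encode, hC, hg],
      fun ρ τ => by simp [QCircuit.apply, hg', hC']⟩

end Extension

/-! ### Circuits with a given description and a given effect on a family of inputs -/

/-- Some circuit with the description `w` maps `S i` to `S' i` for each `i`. -/
def Realizes {ι : Type} {n m : ℕ} (w : List QSymb) (S : ι → Op n) (S' : ι → Op m) : Prop :=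
  ∃ C : QCircuit n m, C.encode = w ∧ ∀ i, C.apply (S i) = S' i

/-- The composition of two circuits. -/
def QCircuit.comp : {n m p : ℕ} → QCircuit n m → QCircuit m p → QCircuit n p
  | _, _, _, .nil, D => D
  | _, _, _, .cons g C, D => .cons g (C.comp D)

theorem QCircuit.encode_comp {n m p : ℕ} (C : QCircuit n m) (D : QCircuit m p) :
    (C.comp D).encode = C.encode ++ D.encode := by
  induction C with
  | nil => rfl
  | cons g C ih => simp [QCircuit.comp, QCircuit.encode, ih]

theorem QCircuit.apply_comp {n m p : ℕ} (C : QCircuit n m) (D : QCircuit m p) (ρ : Op n) :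
    (C.comp D).apply ρ = D.apply (C.apply ρ) := by
  induction C with
  | nil => rfl
  | cons g C ih => simp [QCircuit.comp, QCircuit.apply, ih]

section Realizes

variable {ι : Type} {n m p c N M : ℕ}

theorem Realizes.refl (S : ι → Op n) : Realizes [] S S := ⟨.nil, rfl, fun _ => rfl⟩

theorem Realizes.trans {w w' : List QSymb} {S : ι → Op n} {S' : ι → Op m} {S'' : ι → Op p}
    (h : Realizes w S S') (h' : Realizes w' S' S'') : Realizes (w ++ w') S S'' := by
  obtain ⟨C, rfl, hC⟩ := h
  obtain ⟨D, rfl, hD⟩ := h'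
  exact ⟨C.comp D, C.encode_comp D, fun i => by rw [QCircuit.apply_comp, hC, hD]⟩

theorem QGate.realizes (g : QGate n m) (S : ι → Op n) :
    Realizes g.encode S fun i => g.apply (S i) :=
  ⟨.cons g .nil, by simp [QCircuit.encode], fun _ => rfl⟩

theorem QCircuit.realizes_tens (C : QCircuit n m) (e : n + c = N) (e' : m + c = M)
    (S : ι → Op n) (T : ι → Op c) :
    Realizes C.encode (fun i => tens e (S i) (T i)) fun i => tens e' (C.apply (S i)) (T i) := by
  obtain ⟨C', h, h'⟩ := C.exists_extend e e'
  exact ⟨C', h, fun i => h' _ _⟩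

theorem wireCount_replicate_tick (l : ℕ) (w : List QSymb) (n : ℕ) :
    wireCount (List.replicate l .tick ++ w) n = wireCount w n := by
  induction l with
  | zero => rfl
  | succ l ih => simpa [List.replicate_succ, wireCount] using ih

theorem QCircuit.wireCount_encode_append (C : QCircuit n m) (w : List QSymb) :
    wireCount (C.encode ++ w) n = wireCount w m := by
  induction C with
  | nil => rfl
  | cons g C ih =>
    rw [← ih]
    cases g <;> simp [QCircuit.encode, QGate.encode, wireCount, wireCount_replicate_tick]

theorem QCircuit.wireCount_encode (C : QCircuit n m) : wireCount C.encode n = m := by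
  simpa [wireCount] using C.wireCount_encode_append []

/-! ### Discarding registers -/

/-- The last `b` qubits of a register of `N = a + b` qubits, the others being traced out. -/
noncomputable def traceOut {a b : ℕ} (e : N = a + b) (ρ : Op N) : Op b :=
  traceOutFirst (ρ.submatrix (fun x i => x (Fin.cast e i)) fun x i => x (Fin.cast e i))

/-- The remaining wires move down after each discard, so the gate on wire `0` is simply repeated. -/
theorem realizes_traceOut {a b : ℕ} (e : N = a + b) (S : ι → Op N) :
    Realizes (List.replicate a [QSymb.disc]).flatten S fun i => traceOut e (S i) := by
  induction a generalizing N with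
  | zero =>
    obtain rfl : N = b := by omega
    refine ⟨.nil, rfl, fun i => ?_⟩
    ext x y
    have h : ∀ (x : Bits N) (z : Bits 0), (fun i => Fin.append z x (Fin.cast e i)) = x :=
      fun x z => funext fun i => by
        rw [show Fin.cast e i = Fin.natAdd 0 i from Fin.ext (by simp), Fin.append_right]
    simp [QCircuit.apply, traceOut, traceOutFirst, h]
  | succ a ih =>
    obtain ⟨N', rfl⟩ : ∃ N', N = N' + 1 := ⟨a + b, by omega⟩
    have e' : N' = a + b := by omega
    have h := ((QGate.disc (0 : Fin (N' + 1))).realizes S).trans (ih e' _)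
    simp only [QGate.encode, Fin.val_zero, List.replicate_zero] at h
    rw [List.replicate_succ, List.flatten_cons]
    refine Eq.mp ?_ h
    congr 1
    funext i
    ext x y
    have hc : ∀ (x : Bits b) (z : Bits a) (d : Bool),
        (fun i => Fin.append (Fin.cons d z : Bits (a + 1)) x (Fin.cast e i)) =
          Fin.insertNth (α := fun _ => Bool) (0 : Fin (N' + 1)) d
            (fun i => Fin.append z x (Fin.cast e' i)) := by
      intro x z d
      subst e'
      rw [Fin.insertNth_zero', Fin.append_cons]
      rfl
    simp only [traceOut, traceOutFirst, QGate.apply, Matrix.of_apply, Matrix.submatrix_apply]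
    rw [← (Fin.consEquiv fun _ : Fin (a + 1) => Bool).sum_comp, Fintype.sum_prod_type,
      Finset.sum_comm]
    refine Finset.sum_congr rfl fun z _ => Finset.sum_congr rfl fun d _ => ?_
    rw [← hc, ← hc]
    rfl

/-- The answer of `D` sits on wire `0`, so wire `1` is discarded repeatedly. Each key bit is a basis
state of trace one and leaves no factor behind. -/
theorem realizes_discard_key (e : 1 + c = N) (R : ι → Op 1) (y : ι → Bits c) :
    Realizes (List.replicate c [QSymb.disc, QSymb.tick]).flatten
      (fun i => tens e (R i) (basisState (y i))) R := by
  induction c generalizing N with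
  | zero =>
    obtain rfl : N = 1 := by omega
    refine ⟨.nil, rfl, fun i => ?_⟩
    ext x z
    have h : ∀ x, lowBits e x = x := fun x => funext fun i => congrArg x (Fin.ext (by simp))
    change tens e (R i) (basisState (y i)) x z = R i x z
    rw [tens_apply, h, h, Subsingleton.elim (highBits e x) (y i),
      Subsingleton.elim (highBits e z) (y i)]
    simp [basisState]
  | succ c ih =>
    obtain ⟨N', rfl⟩ : ∃ N', N = N' + 1 := ⟨1 + c, by omega⟩
    have e' : 1 + c = N' := by omega
    have hN : 1 < N' + 1 := by omega
    have h := (QGate.disc (⟨1, hN⟩ : Fin (N' + 1))).realizes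
      fun i => tens e (R i) (basisState (y i))
    rw [List.replicate_succ, List.flatten_cons]
    refine Realizes.trans (w := [QSymb.disc, QSymb.tick]) (Eq.mp ?_ h) (ih e' fun i => Fin.tail (y i))
    congr 1
    funext i
    have hs : ∀ j : Fin N', ((⟨1, hN⟩ : Fin (N' + 1)).succAbove j : ℕ) =
        if (j : ℕ) < 1 then (j : ℕ) else j + 1 := fun j => by
      simp only [Fin.succAbove, Fin.lt_def, Fin.val_castSucc]
      split_ifs <;> rfl
    have hl : ∀ (b : Bool) (x : Bits N'),
        lowBits e (Fin.insertNth (α := fun _ => Bool) ⟨1, hN⟩ b x) = lowBits e' x := by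
      intro b x
      funext j
      have : Fin.cast e (Fin.castAdd (c + 1) j) =
          (⟨1, hN⟩ : Fin (N' + 1)).succAbove (Fin.cast e' (Fin.castAdd c j)) := by
        ext; rw [hs]; simp
      simp [lowBits, this]
    have hh : ∀ (b : Bool) (x : Bits N'),
        highBits e (Fin.insertNth (α := fun _ => Bool) ⟨1, hN⟩ b x) =
          Fin.cons b (highBits e' x) := by
      intro b x
      funext j
      refine Fin.cases ?_ (fun j => ?_) j
      · have : Fin.cast e (Fin.natAdd 1 (0 : Fin (c + 1))) = ⟨1, hN⟩ := by ext; simp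
        simp [highBits, this]
      · have : Fin.cast e (Fin.natAdd 1 j.succ) =
            (⟨1, hN⟩ : Fin (N' + 1)).succAbove (Fin.cast e' (Fin.natAdd 1 j)) := by
          ext; rw [hs]; simp; omega
        simp [highBits, this]
    ext x z
    simp only [QGate.apply, Matrix.of_apply, tens_apply, hl, hh, ← Finset.mul_sum]
    congr 1
    have hy : ∀ (b : Bool) (u : Bits c), y i = Fin.cons b u ↔ y i 0 = b ∧ Fin.tail (y i) = u :=
      fun b u => by
      constructor
      · intro h; rw [h]; simp
      · rintro ⟨rfl, rfl⟩; simp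
    simp only [basisState, Matrix.single_apply, hy, Fintype.sum_bool]
    cases y i 0 <;> simp

end Realizes

/-! ### The action of Pauli operators -/

section Pauli

variable {n : ℕ}

theorem pauliX_pow_mul_apply (i : Fin n) (a : Bool) (ρ : Op n) (x y : Bits n) :
    (onWire i pauliX ^ a.toNat * ρ) x y = ρ (update x i (xor (x i) a)) y := by
  cases a
  · simp
  · rw [Bool.toNat_true, pow_one, onWire_mul_apply, Fintype.sum_bool]
    cases x i <;> simp [pauliX]

theorem pauliZ_pow_mul_apply (i : Fin n) (z : Bool) (ρ : Op n) (x y : Bits n) :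
    (onWire i pauliZ ^ z.toNat * ρ) x y = (if z && x i then -1 else 1) * ρ x y := by
  cases z
  · simp
  · rw [Bool.toNat_true, pow_one, onWire_mul_apply, Fintype.sum_bool]
    have : update x i (x i) = x := update_eq_self i x
    cases h : x i <;> rw [h] at this <;> simp [pauliZ, this]

/-- Reduces right multiplication by an adjoint to left multiplication, so the action of Pauli
operators need only be computed on rows. -/
theorem mul_conjTranspose_apply (A ρ : Op n) (x y : Bits n) :
    (ρ * A.conjTranspose) x y = star ((A * ρ.conjTranspose) y x) := by
  rw [← Matrix.conjTranspose_apply, Matrix.conjTranspose_mul, Matrix.conjTranspose_conjTranspose]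

theorem pauliX_pow_conj_apply (i : Fin n) (a : Bool) (ρ : Op n) (x y : Bits n) :
    (onWire i pauliX ^ a.toNat * ρ * (onWire i pauliX ^ a.toNat).conjTranspose) x y =
      ρ (update x i (xor (x i) a)) (update y i (xor (y i) a)) := by
  rw [mul_conjTranspose_apply, pauliX_pow_mul_apply, Matrix.conjTranspose_apply, star_star,
    pauliX_pow_mul_apply]

theorem sqrt_two_inv_mul_self : (((1 : ℝ) / √2 : ℝ) : ℂ) * ((1 / √2 : ℝ) : ℂ) = 1 / 2 := by
  rw [← Complex.ofReal_mul, div_mul_div_comm, Real.mul_self_sqrt (by norm_num)]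
  norm_num

theorem hadamard_eq : hadamard = ((1 / √2 : ℝ) : ℂ) •
    Matrix.of fun a b : Bool => (if a && b then -1 else 1 : ℂ) := by
  ext a b
  cases a <;> cases b <;> simp [hadamard, neg_div]

theorem hadamard_mul_hadamard : hadamard * hadamard = 1 := by
  rw [hadamard_eq, Matrix.smul_mul, Matrix.mul_smul, smul_smul, sqrt_two_inv_mul_self]
  ext a b
  cases a <;> cases b <;> simp [Matrix.mul_apply]
  all_goals norm_num

theorem hadamard_mul_pauliX_mul_hadamard : hadamard * pauliX * hadamard = pauliZ := by
  rw [hadamard_eq, Matrix.mul_smul, Matrix.smul_mul, Matrix.smul_mul, smul_smul,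
    sqrt_two_inv_mul_self]
  ext a b
  cases a <;> cases b <;> simp [Matrix.mul_apply, pauliX, pauliZ] <;> norm_num

theorem onWire_hadamard_conj_pow (i : Fin n) (z : Bool) :
    onWire i hadamard * onWire i pauliX ^ z.toNat * onWire i hadamard =
      onWire i pauliZ ^ z.toNat := by
  cases z
  · simp [onWire_mul, hadamard_mul_hadamard, onWire_one]
  · simp [onWire_mul, hadamard_mul_pauliX_mul_hadamard]

/-- A product of Pauli operators on different wires. -/
theorem prod_pauli_mul_apply {κ : Type} [DecidableEq κ] (w : κ → Fin n) (hw : Injective w)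
    (a z : κ → Bool) (L : List κ) (hL : L.Nodup) (ρ : Op n) (x y x' : Bits n)
    (hx : ∀ j ∈ L, x' (w j) = xor (x (w j)) (a j)) (hx' : ∀ i, (∀ j ∈ L, i ≠ w j) → x' i = x i) :
    ((L.map fun j => onWire (w j) pauliX ^ (a j).toNat * onWire (w j) pauliZ ^ (z j).toNat).prod
      * ρ) x y = (L.map fun j => (if z j && x' (w j) then -1 else 1 : ℂ)).prod * ρ x' y := by
  induction L generalizing x with
  | nil =>
    obtain rfl : x' = x := funext fun i => hx' i (by simp)
    simp
  | cons j L ih =>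
    rw [List.nodup_cons] at hL
    -- The `X` factor flips the row bit first, so the sign of the `Z` factor is evaluated at the
    -- flipped bit `x' (w j)`.
    rw [List.map_cons, List.prod_cons, Matrix.mul_assoc, Matrix.mul_assoc, pauliX_pow_mul_apply,
      pauliZ_pow_mul_apply, update_self, ← hx j (by simp), ih hL.2, List.map_cons, List.prod_cons,
      mul_assoc]
    · intro i hi
      have : w i ≠ w j := fun h => hL.1 (hw h ▸ hi)
      rw [update_of_ne this]
      exact hx i (by simp [hi])
    · intro i hi
      by_cases h : i = w j
      · subst h; rw [update_self]
      · rw [update_of_ne h]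
        exact hx' i fun l hl => by
          rcases List.mem_cons.1 hl with rfl | hl
          · exact h
          · exact hi l hl

/-- The `X`-part of a key. -/
def keyX {k : ℕ} (r : Bits (2 * k)) : Bits k := fun j => r ⟨2 * j, by omega⟩

/-- The `Z`-part of a key. -/
def keyZ {k : ℕ} (r : Bits (2 * k)) : Bits k := fun j => r ⟨2 * j + 1, by omega⟩

/-- A key consists of its two parts. -/
def keyEquiv (k : ℕ) : Bits (2 * k) ≃ Bits k × Bits k where
  toFun r := (keyX r, keyZ r)
  invFun p i := if (i : ℕ) % 2 = 0 then p.1 ⟨i / 2, by omega⟩ else p.2 ⟨i / 2, by omega⟩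
  left_inv r := by
    funext i
    simp only [keyX, keyZ]
    split_ifs with h
    · exact congrArg r (Fin.ext (by simp only; omega))
    · exact congrArg r (Fin.ext (by simp only; omega))
  right_inv p := by
    ext j
    · simp [keyX]
    · simp only [keyZ]
      rw [if_neg (by omega)]
      exact congrArg p.2 (Fin.ext (by simp only; omega))

theorem tensor_pauli_one {k b : ℕ} (r : Bits (2 * k)) :
    tensor (pauli r) (1 : Op b) = ((List.finRange k).map fun j =>
      onWire (Fin.castAdd b j) pauliX ^ (keyX r j).toNat *
        onWire (Fin.castAdd b j) pauliZ ^ (keyZ r j).toNat).prod := by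
  have hp : ∀ (i : Fin k) (U : Matrix Bool Bool ℂ) (m : ℕ),
      onWire (Fin.castAdd b i) U ^ m = tens rfl (onWire i U ^ m) (1 : Op b) := by
    intro i U m
    induction m with
    | zero => simp [tens_one]
    | succ m ih =>
      rw [pow_succ, ih, pow_succ, show Fin.castAdd b i = Fin.cast rfl (Fin.castAdd b i) from rfl,
        onWire_tens, tens_mul, Matrix.one_mul]
  have hL : ∀ (L : List (Fin k)) (A : Fin k → Op k),
      tens rfl (L.map A).prod (1 : Op b) = (L.map fun j => tens rfl (A j) (1 : Op b)).prod := by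
    intro L A
    induction L with
    | nil => exact tens_one rfl
    | cons j L ih => rw [List.map_cons, List.prod_cons, List.map_cons, List.prod_cons, ← ih,
        tens_mul, Matrix.one_mul]
  rw [tensor_eq_tens, pauli, List.ofFn_eq_map, hL]
  simp only [hp, tens_mul, Matrix.one_mul]
  rfl

/-- The string `x` with the first bits flipped according to `a`. -/
def flipFirst {k b : ℕ} (a : Bits k) (x : Bits (k + b)) : Bits (k + b) :=
  Fin.append (fun j => xor (x (Fin.castAdd b j)) (a j)) fun j => x (Fin.natAdd k j)

theorem padFirst_apply {k b : ℕ} (r : Bits (2 * k)) (ρ : Op (k + b)) (x y : Bits (k + b)) :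
    padFirst r ρ x y = (∏ j, (if keyZ r j && xor (x (Fin.castAdd b j)) (keyX r j) then -1 else 1)
      * (if keyZ r j && xor (y (Fin.castAdd b j)) (keyX r j) then -1 else 1)) *
      ρ (flipFirst (keyX r) x) (flipFirst (keyX r) y) := by
  have h : ∀ (ρ : Op (k + b)) (x y : Bits (k + b)), (tensor (pauli r) (1 : Op b) * ρ) x y =
      (∏ j, (if keyZ r j && xor (x (Fin.castAdd b j)) (keyX r j) then -1 else 1)) *
        ρ (flipFirst (keyX r) x) y := by
    intro ρ x y
    rw [tensor_pauli_one, prod_pauli_mul_apply (Fin.castAdd b) (Fin.castAdd_injective k b) _ _ _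
      (List.nodup_finRange k) ρ x y (flipFirst (keyX r) x)]
    · rw [← List.ofFn_eq_map, List.prod_ofFn]
      simp [flipFirst]
    · simp [flipFirst]
    · intro i hi
      refine Fin.addCases (fun i hi => ?_) (fun i _ => ?_) i hi
      · exact absurd rfl (hi i (List.mem_finRange i))
      · simp [flipFirst]
  rw [padFirst, mul_conjTranspose_apply, h, star_mul', Matrix.conjTranspose_apply, star_star, h,
    Finset.prod_mul_distrib]
  have hs : ∀ b : Bool, star (if b then -1 else 1 : ℂ) = if b then -1 else 1 := by
    intro b; cases b <;> simp
  rw [star_prod]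
  simp only [hs]
  ring

/-- The one-time pad with a uniformly random key. -/
theorem sum_padFirst {k b : ℕ} (ρ : Op (k + b)) :
    ∑ r, padFirst r ρ = (2 : ℂ) ^ k • tensor 1 (traceOutFirst ρ) := by
  ext x y
  rw [Matrix.sum_apply, ← (keyEquiv k).symm.sum_comp, Fintype.sum_prod_type]
  have hk : ∀ a z : Bits k, keyX ((keyEquiv k).symm (a, z)) = a ∧
      keyZ ((keyEquiv k).symm (a, z)) = z := fun a z =>
    ⟨congrArg Prod.fst ((keyEquiv k).apply_symm_apply (a, z)),
      congrArg Prod.snd ((keyEquiv k).apply_symm_apply (a, z))⟩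
  simp only [padFirst_apply, hk, ← Finset.sum_mul]
  -- Orthogonality of characters, wire by wire: the two signs cancel when the bits of `x` and `y`
  -- agree and sum to zero otherwise.
  have hz : ∀ a : Bits k, ∑ z : Bits k, ∏ j,
      (if z j && xor (x (Fin.castAdd b j)) (a j) then -1 else 1 : ℂ) *
        (if z j && xor (y (Fin.castAdd b j)) (a j) then -1 else 1) =
      if lowBits rfl x = lowBits rfl y then 2 ^ k else 0 := by
    intro a
    rw [← Fintype.prod_sum (fun j (c : Bool) =>
      (if c && xor (x (Fin.castAdd b j)) (a j) then -1 else 1 : ℂ) *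
        (if c && xor (y (Fin.castAdd b j)) (a j) then -1 else 1))]
    have hb : ∀ u v c : Bool, ∑ d : Bool, (if d && xor u c then -1 else 1 : ℂ) *
        (if d && xor v c then -1 else 1) = if u = v then 2 else 0 := by
      intro u v c
      cases u <;> cases v <;> cases c <;> simp <;> norm_num
    simp only [hb]
    split_ifs with h
    · have : ∀ j : Fin k, x (Fin.castAdd b j) = y (Fin.castAdd b j) := fun j => congrFun h j
      simp [this]
    · obtain ⟨j, hj⟩ := Function.ne_iff.1 h
      exact Finset.prod_eq_zero (Finset.mem_univ j) (if_neg hj)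
  simp only [hz, Matrix.smul_apply, tensor_eq_tens, tens_apply, Matrix.one_apply, smul_eq_mul]
  by_cases h : lowBits rfl x = lowBits rfl y
  · simp only [if_pos h, one_mul, ← Finset.mul_sum]
    congr 1
    -- For fixed `x`, the flip by `a` runs through all strings on `A`, which turns the sum over `a`
    -- into the partial trace.
    let e : Bits k ≃ Bits k :=
      { toFun := fun a j => xor (x (Fin.castAdd b j)) (a j)
        invFun := fun a j => xor (x (Fin.castAdd b j)) (a j)
        left_inv := fun a => by funext j; simp
        right_inv := fun a => by funext j; simp }
    refine Fintype.sum_equiv e _ _ fun a => ?_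
    have hy : flipFirst a y = Fin.append (e a) (highBits rfl y) := by
      have : (fun j => xor (y (Fin.castAdd b j)) (a j)) = e a := funext fun j =>
        congrArg (xor · (a j)) (congrFun h j).symm
      rw [flipFirst, this]; rfl
    rw [hy]; rfl
  · simp [if_neg h]

theorem traceOutFirst_tensor {k b : ℕ} (σ : Op k) (τ : Op b) :
    traceOutFirst (tensor σ τ) = σ.trace • τ := by
  ext x y
  have hl : ∀ (z : Bits k) (x : Bits b), lowBits rfl (Fin.append z x) = z := fun z x =>
    funext fun i => Fin.append_left z x i
  have hh : ∀ (z : Bits k) (x : Bits b), highBits rfl (Fin.append z x) = x := fun z x =>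
    funext fun i => Fin.append_right z x i
  simp [traceOutFirst, tensor_eq_tens, tens_apply, hl, hh, Matrix.trace, Finset.sum_mul]

end Pauli

/-! ### A circuit for the one-time pad -/

section PadCircuit

variable {n c N : ℕ}

theorem realizes_had (e : n + c = N) (i : Fin n) (S : Bits c → Op n) :
    Realizes (.had :: List.replicate i .tick) (fun y => tens e (S y) (basisState y))
      fun y => tens e (onWire i hadamard * S y * (onWire i hadamard).conjTranspose)
        (basisState y) := by
  have := (QCircuit.cons (.had i) .nil).realizes_tens e e S fun y : Bits c => basisState y
  rwa [QCircuit.encode, QCircuit.encode, List.append_nil] at this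

/-- Entries of `basisState y` vanish unless both key indices equal `y`; on the others the control
bit is the constant `y l`, so the gate acts as a power of `X` on the target. -/
theorem realizes_cnot (e : n + c = N) (i : Fin n) (l : Fin c) (S : Bits c → Op n) :
    Realizes (.cnot :: (List.replicate (n + l) .tick ++ .sep :: List.replicate i .tick))
      (fun y => tens e (S y) (basisState y))
      fun y => tens e (onWire i pauliX ^ (y l).toNat * S y *
        (onWire i pauliX ^ (y l).toNat).conjTranspose) (basisState y) := by
  have hne : Fin.cast e (Fin.natAdd n l) ≠ Fin.cast e (Fin.castAdd c i) := by
    simp [Fin.ext_iff]; omega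
  refine ⟨.cons (.cnot _ _ hne) .nil, by simp [QCircuit.encode, QGate.encode], fun y => ?_⟩
  ext x z
  simp only [QCircuit.apply, QGate.apply, Matrix.submatrix_apply, tens_apply,
    lowBits_update_low, highBits_update_low, pauliX_pow_conj_apply]
  by_cases h : y = highBits e x ∧ y = highBits e z
  · obtain ⟨h₁, h₂⟩ := h
    have hx : x (Fin.cast e (Fin.natAdd n l)) = y l := congrFun h₁.symm l
    have hz : z (Fin.cast e (Fin.natAdd n l)) = y l := congrFun h₂.symm l
    rw [hx, hz]
    rfl
  · simp [basisState, h]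

/-- Conjugating the first controlled-not by Hadamard gates makes it a controlled `Z`; the second
supplies `X`. -/
theorem realizes_padBlock (e : n + c = N) (i : Fin n) (l : ℕ) (hl : l + 1 < c)
    (S : Bits c → Op n) :
    Realizes (padBlock i (n + l)) (fun y => tens e (S y) (basisState y)) fun y => tens e
      ((onWire i pauliX ^ (y ⟨l, by omega⟩).toNat * onWire i pauliZ ^ (y ⟨l + 1, hl⟩).toNat) * S y *
        (onWire i pauliX ^ (y ⟨l, by omega⟩).toNat *
          onWire i pauliZ ^ (y ⟨l + 1, hl⟩).toNat).conjTranspose) (basisState y) := by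
  have h := (((realizes_had e i S).trans (realizes_cnot e i ⟨l + 1, hl⟩ _)).trans
    (realizes_had e i _)).trans (realizes_cnot e i ⟨l, by omega⟩ _)
  refine Eq.mp ?_ h
  congr 1
  · simp [padBlock, Nat.add_assoc]
  · funext y
    congr 1
    rw [← onWire_hadamard_conj_pow]
    simp only [Matrix.conjTranspose_mul, Matrix.mul_assoc]

/-- The rightmost factor of a product acts first, which is why `padWord` starts with the block of
the last wire. -/
theorem realizes_padWord {k b : ℕ} (e : k + b + 2 * k = N) (ρ : Op (k + b)) :
    Realizes (padWord k (k + b)) (fun y => tens e ρ (basisState y))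
      fun y => tens e (padFirst y ρ) (basisState y) := by
  have key : ∀ m (hm : m ≤ k) (S : Bits (2 * k) → Op (k + b)),
      Realizes (padWord m (k + b)) (fun y => tens e (S y) (basisState y)) fun y =>
        let A := ((List.finRange m).map fun j => onWire (Fin.castAdd b (Fin.castLE hm j)) pauliX ^
          (keyX y (Fin.castLE hm j)).toNat * onWire (Fin.castAdd b (Fin.castLE hm j)) pauliZ ^
          (keyZ y (Fin.castLE hm j)).toNat).prod
        tens e (A * S y * A.conjTranspose) (basisState y) := by
    intro m
    induction m with
    | zero => intro hm S; simpa [padWord] using Realizes.refl _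
    | succ m ih =>
      intro hm S
      have h := (realizes_padBlock e (Fin.castAdd b ⟨m, hm⟩) (2 * m) (by omega) S).trans
        (ih (by omega) _)
      refine Eq.mp ?_ h
      congr 1
      funext y
      simp only [List.finRange_succ_last, List.map_append, List.prod_append, List.map_map,
        List.map_cons, List.map_nil, List.prod_singleton, Matrix.conjTranspose_mul,
        Matrix.mul_assoc]
      rfl
  have h := key k le_rfl fun _ => ρ
  simp only [padFirst, tensor_pauli_one]
  exact h

end PadCircuit

/-! ### Linearity -/

theorem QGate.apply_add {n m : ℕ} (g : QGate n m) (ρ τ : Op n) :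
    g.apply (ρ + τ) = g.apply ρ + g.apply τ := by
  cases g <;> ext x y <;> simp only [QGate.apply, Matrix.of_apply, Matrix.add_apply,
    Finset.sum_add_distrib, Matrix.mul_add, Matrix.add_mul, Matrix.submatrix_apply] <;>
    (try split_ifs) <;> simp

theorem QCircuit.apply_add {n m : ℕ} (C : QCircuit n m) (ρ τ : Op n) :
    C.apply (ρ + τ) = C.apply ρ + C.apply τ := by
  induction C with
  | nil => rfl
  | cons g C ih => simp [QCircuit.apply, QGate.apply_add, ih]

/-- For a nonempty sum, additivity of the circuit maps suffices. -/
theorem sum_prOne {ι : Type} {n : ℕ} (D : QCircuit n 1) (s : Finset ι) (hs : s.Nonempty)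
    (ρ : ι → Op n) : ∑ i ∈ s, prOne D (ρ i) = prOne D (∑ i ∈ s, ρ i) := by
  induction hs using Finset.Nonempty.cons_induction with
  | singleton i => simp
  | cons i s hi _ ih =>
    rw [Finset.sum_cons, Finset.sum_cons, ih, prOne, prOne, prOne, QCircuit.apply_add]
    simp

/-! ### Negligible functions -/

theorem Negligible.add {f g : ℕ → ℝ} (hf : Negligible f) (hg : Negligible g) :
    Negligible fun n => f n + g n := by
  intro p hp
  have h2 : (2 * p : Polynomial ℕ) ≠ 0 := mul_ne_zero two_ne_zero hp
  filter_upwards [hf _ h2, hg _ h2] with n hfn hgn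
  have : (1 : ℝ) / ((Polynomial.eval n (2 * p) : ℕ) : ℝ) = 1 / ((p.eval n : ℕ) : ℝ) / 2 := by
    simp [Polynomial.eval_mul, div_eq_mul_inv, mul_comm]
  rw [this] at hfn hgn
  linarith

theorem Negligible.mono {f g : ℕ → ℝ} (hg : Negligible g) (h : ∀ n, f n ≤ g n) :
    Negligible f := fun p hp => (hg p hp).mono fun n hn => (h n).trans_lt hn

/-! ### The reduction -/

/-- The distinguisher for keys that prepares a state, applies the one-time pad with the given key
and runs `D`. -/
theorem exists_key_distinguisher {k b : ℕ} (C : QCircuit 0 (k + b)) (D : QCircuit (k + b) 1) :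
    ∃ D' : QCircuit (2 * k) 1,
      D'.encode = C.encode ++ (padWord k (k + b) ++ (D.encode ++
        (List.replicate (2 * k) [QSymb.disc, QSymb.tick]).flatten)) ∧
      ∀ y, D'.apply (basisState y) = D.apply (padFirst y (C.apply 1)) := by
  have h₁ := C.realizes_tens (zero_add (2 * k)) (M := k + b + 2 * k) rfl (fun _ => 1) basisState
  have h₂ := realizes_padWord (k := k) (b := b) rfl (C.apply 1)
  have h₃ := D.realizes_tens (N := k + b + 2 * k) rfl (M := 1 + 2 * k) rfl
    (fun y => padFirst y (C.apply 1)) basisState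
  have h₄ := realizes_discard_key (N := 1 + 2 * k) rfl
    (fun y : Bits (2 * k) => D.apply (padFirst y (C.apply 1))) fun y => y
  obtain ⟨D', h, h'⟩ := h₁.trans (h₂.trans (h₃.trans h₄))
  refine ⟨D', h, fun y => ?_⟩
  simpa only [tens_zero_left] using h' y

/-- A preparation circuit starts with no wires, so its description alone determines how many it
outputs. -/
theorem EfficientlyPreparable.printable_outWires {a : ℕ → ℕ} {ρ : ∀ n, Op (a n)}
    (hρ : EfficientlyPreparable ρ) :
    PolyTimePrintable fun n => List.replicate (a n) QSymb.tick := by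
  obtain ⟨C, hC, _⟩ := hρ
  have := PolyTimePrintable.wireCount hC
  simpa only [QCircuit.wireCount_encode] using this

/-- A pseudorandom key instead of a uniformly random one does not help to distinguish. -/
theorem IsQPRG.negligible_padFirst {k b : ℕ → ℕ} {G : ∀ n, Bits n → Bits (2 * k n)}
    (hG : IsQPRG G) (hk : PolyTimePrintable fun n => List.replicate (k n) QSymb.tick)
    {ρ : ∀ n, Op (k n + b n)} (hρ : EfficientlyPreparable ρ)
    {D : ∀ n, QCircuit (k n + b n) 1} (hD : IsQPT D) :
    Negligible fun n => |unifAvg (fun s : Bits n => prOne (D n) (padFirst (G n s) (ρ n))) -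
      unifAvg fun y => prOne (D n) (padFirst y (ρ n))| := by
  have hkb := hρ.printable_outWires
  obtain ⟨C, hC, hCρ⟩ := hρ
  choose D' hD' hD'' using fun n => exists_key_distinguisher (C n) (D n)
  have h2k : PolyTimePrintable fun n => List.replicate (2 * k n) QSymb.tick := by
    simpa only [two_mul, List.replicate_add] using hk.append hk
  have hqpt : IsQPT D' := by
    have := PolyTimePrintable.append hC ((hk.padWord hkb).append
      (PolyTimePrintable.append hD (h2k.flatten_replicate [.disc, .tick])))
    simpa only [IsQPT, hD'] using this
  have h := hG.2 D' hqpt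
  simpa only [prOne, hD'', hCρ] using h

/-- Prepare `ρ`, discard its first `k n` wires, then run the preparation of `σ` beside the rest. New
wires enter at the front, so `σ` lands on register `A`. -/
theorem EfficientlyPreparable.tensor_traceOutFirst {k b : ℕ → ℕ} {ρ : ∀ n, Op (k n + b n)}
    (hρ : EfficientlyPreparable ρ) {σ : ∀ n, Op (k n)} (hσ : EfficientlyPreparable σ) :
    EfficientlyPreparable fun n => tensor (σ n) (traceOutFirst (ρ n)) := by
  have hk := hσ.printable_outWires
  obtain ⟨C, hC, hCρ⟩ := hρ
  obtain ⟨E, hE, hEσ⟩ := hσ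
  have h : ∀ n, ∃ F : QCircuit 0 (k n + b n),
      F.encode = (C n).encode ++ ((List.replicate (k n) [QSymb.disc]).flatten ++ (E n).encode) ∧
      F.apply 1 = tensor (σ n) (traceOutFirst (ρ n)) := by
    intro n
    have h₁ : Realizes (C n).encode (fun _ : Unit => (1 : Op 0)) fun _ => ρ n :=
      ⟨C n, rfl, fun _ => hCρ n⟩
    have h₂ := realizes_traceOut (b := b n) rfl fun _ : Unit => ρ n
    have h₃ := (E n).realizes_tens (zero_add (b n)) (M := k n + b n) rfl (fun _ : Unit => 1)
      fun _ => traceOutFirst (ρ n)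
    simp only [tens_zero_left] at h₃
    obtain ⟨F, hF, hF'⟩ := h₁.trans (h₂.trans h₃)
    exact ⟨F, hF, by rw [hF' (), hEσ, tensor_eq_tens]⟩
  choose F hF hF' using h
  refine ⟨F, ?_, hF'⟩
  have := PolyTimePrintable.append hC ((hk.flatten_replicate [.disc]).append hE)
  simpa only [IsQPT, hF] using this

/-- With a uniformly random key, the one-time pad hides the register completely. -/
theorem unifAvg_padFirst {k b : ℕ} (ρ : Op (k + b)) (σ : Op k) (hσ : σ.trace = 1)
    (D : QCircuit (k + b) 1) :
    unifAvg (fun y => prOne D (padFirst y ρ)) =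
      unifAvg fun y => prOne D (padFirst y (tensor σ (traceOutFirst ρ))) := by
  rw [unifAvg, unifAvg, sum_prOne D _ Finset.univ_nonempty, sum_prOne D _ Finset.univ_nonempty,
    sum_padFirst, sum_padFirst, traceOutFirst_tensor, hσ, one_smul]

end QCrypt

theorem mainTheorem6 (k b : ℕ → ℕ) (G : ∀ n, Bits n → Bits (2 * k n)) (hG : IsQPRG G)
    (ρ : ∀ n, Op (k n + b n)) (hρ : ∀ n, IsDensity (ρ n)) (hρ_prep : EfficientlyPreparable ρ)
    (σ : ∀ n, Op (k n)) (hσ : ∀ n, IsDensity (σ n)) (hσ_prep : EfficientlyPreparable σ)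
    (D : ∀ n, QCircuit (k n + b n) 1) (hD : IsQPT D) :
    Negligible fun n =>
      |unifAvg (fun s : Bits n => prOne (D n) (padFirst (G n s) (ρ n))) -
        unifAvg (fun s : Bits n =>
          prOne (D n) (padFirst (G n s) (tensor (σ n) (traceOutFirst (ρ n)))))| := by
  have hk := hσ_prep.printable_outWires
  have h₁ := hG.negligible_padFirst hk hρ_prep hD
  have h₂ := hG.negligible_padFirst hk (hρ_prep.tensor_traceOutFirst hσ_prep) hD
  refine (h₁.add h₂).mono fun n => ?_
  -- The uniform-key averages of the two states coincide and serve as the common midpoint of the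
  -- triangle inequality.
  rw [unifAvg_padFirst (ρ n) (σ n) (hσ n).2 (D n)]
  exact dist_triangle_right (α := ℝ) _ _ _
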